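/- **Setting.** A matrix $A\in\mathbb{R}^{n\times m}$ defines the zero-sum game $\min_{x\in\Delta^n}\max_{y\in\Delta^m}\langle x,Ay\rangle$ with value $v$, where $\Delta^d$ is the set of probability vectors in $\mathbb{R}^d$. Write $\mathcal Z=\Delta^n\times\Delta^m$, $z=(x,y)$, $F(z)=(Ay,-A^\top x)$, let $\|\cdot\|$ be the Euclidean norm of vectors and the spectral norm of matrices, $\Pi_{\mathcal Z}$ the Euclidean projection onto $\mathcal Z$, $D_{\mathcal Z}$ the Euclidean diameter of $\mathcal Z$, and $$\Phi(x,y)=\max_{y'\in\Delta^m}\langle x,Ay'\rangle-\min_{x'\in\Delta^n}\langle x',Ay\rangle$$ the duality gap. A point $z\in\mathcal Z$ is an $\epsilon$-equilibrium if $\Phi(z)\le\epsilon$. The game is *non-degenerate* if it has a unique equilibrium $(x^\star,y^\star)$, exactly $n$ of the inequalities $x_i\ge0$ $(i\le n)$, $\langle x,A_{:,j}\rangle\le v$ $(j\le m)$ are tight at $x^\star$, and exactly $m$ of the inequalities $y_j\ge0$ $(j\le m)$, $\langle y,A_{i,:}\rangle\ge v$ $(i\le n)$ are tight at $y^\star$.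 It is *$\delta$-support-stable*, $\delta>0$, if it is non-degenerate and every $A'$ with $\|A-A'\|\le\delta$ is non-degenerate with equilibrium strategies of the same supports as those of $A$. **Algorithms**, with a starting point $z^{(0)}\in\mathcal Z$ and a number $L>0$: * OGDA, with learning rate $\eta$: $\hat z^{(1)}=z^{(0)}$ and, for $t\ge1$, $z^{(t)}=\Pi_{\mathcal Z}(\hat z^{(t)}-\eta F(z^{(t-1)}))$, $\hat z^{(t+1)}=\Pi_{\mathcal Z}(\hat z^{(t)}-\eta F(z^{(t)}))$. * EGDA, with learning rate $\eta$: for $t\ge0$, $\hat z^{(t)}=\Pi_{\mathcal Z}(z^{(t)}-\eta F(z^{(t)}))$, $z^{(t+1)}=\Pi_{\mathcal Z}(z^{(t)}-\eta F(\hat z^{(t)}))$. * Smoothing$(A,z^{(0)},\epsilon)$: let $\eta=\epsilon/D_{\mathcal Z}$, $\hat z^{(0)}=z^{(0)}$ and $F_\eta(z)=\max_{w\in\mathcal Z}\{\langle F(z),z-w\rangle-\frac\eta2\|w-\bar z\|^2\}$, where $\bar z$ is the pair of uniform distributions. For $t=0,1,\dots$ put $u^{(t)}=\frac2{t+2}\hat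 z^{(t)}+\frac t{t+2}z^{(t)}$ and $z^{(t+1)}=\arg\min_{z\in\mathcal Z}\{\langle\nabla F_\eta(u^{(t)}),z-u^{(t)}\rangle+\frac{L^2}{2\eta}\|z-u^{(t)}\|^2\}$; return $z^{(t+1)}$ if $\Phi(z^{(t+1)})<\epsilon$; otherwise put $\hat z^{(t+1)}=\arg\min_{w\in\mathcal Z}\{\sum_{\tau=0}^t\frac{\tau+1}2\langle\nabla F_\eta(u^{(\tau)}),w-u^{(\tau)}\rangle+\frac{L^2}{2\eta}\|w-z^{(0)}\|^2\}$. * IterSmooth$(A,z^{(0)},\rho,\epsilon)$, with $\rho>1$: let $\epsilon^{(0)}=\Phi(z^{(0)})$. For $t=0,1,\dots$ put $\epsilon^{(t+1)}=\epsilon^{(t)}/\rho$ and $z^{(t+1)}=\text{Smoothing}(A,z^{(t)},\epsilon^{(t+1)})$; return $z^{(t+1)}$ if $\Phi(z^{(t+1)})<\epsilon$. Its number of iterations is the total number of iterations inside all the calls to Smoothing. **Statement.** There are absolute constants $C$ and $k$ such that the following holds. Let $A\in\mathbb{R}^{n\times m}$ be a $\delta$-support-stable game with $|A_{i,j}|\le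 M$ for all $i,j$, where $M>0$; let $0<\epsilon\le M/2$, let $L>0$ satisfy $\|A\|\le L\le nmM$, let $z^{(0)}\in\mathcal Z$, and put $$T=C\,\Bigl(n+m+\frac M\delta\Bigr)^k\log\frac M\epsilon .$$ 1. The iterates of OGDA with $\eta=1/(8L)$ are $\epsilon$-equilibria for all $t\ge T$. 2. The iterates of EGDA with $\eta=1/(8L)$ are $\epsilon$-equilibria for all $t\ge T$. 3. For every $\rho>1$, if $\Phi(z^{(0)})\ne0$ (that is, if $z^{(0)}$ is not already an equilibrium), then IterSmooth$(A,z^{(0)},\rho,\epsilon)$ returns an $\epsilon$-equilibrium after at most $\rho\,(1+1/\log\rho)\,T$ iterations. In particular, for payoffs in $[-1,1]$ (that is, $M=1$), all three algorithms reach an $\epsilon$-equilibrium within $\mathrm{poly}(n,m,1/\delta)\cdot\log(1/\epsilon)$ iterations (for fixed $\rho$). -/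

import Mathlib

open scoped Matrix

namespace ZeroSum

/-- The space `ℝⁿ × ℝᵐ` of strategy profiles `z = (x, y)`, with the Euclidean norm. -/
abbrev Profile (n m : ℕ) : Type := EuclideanSpace ℝ (Fin n ⊕ Fin m)

/-- The first component `x` of `z = (x, y)`. -/
def xPart {n m : ℕ} (z : Profile n m) : Fin n → ℝ := fun i => z (Sum.inl i)

/-- The second component `y` of `z = (x, y)`. -/
def yPart {n m : ℕ} (z : Profile n m) : Fin m → ℝ := fun j => z (Sum.inr j)

/-- The feasible set `Z = Δⁿ × Δᵐ`. -/
def feasible (n m : ℕ) : Set (Profile n m) :=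
  {z | xPart z ∈ stdSimplex ℝ (Fin n) ∧ yPart z ∈ stdSimplex ℝ (Fin m)}

/-- The spectral norm of a matrix (operator norm for the Euclidean norms). -/
noncomputable def specNorm {n m : ℕ} (A : Matrix (Fin n) (Fin m) ℝ) : ℝ :=
  ‖(Matrix.toEuclideanLin A).toContinuousLinearMap‖

/-- The operator `F(x, y) = (A y, -Aᵀ x)`. -/
noncomputable def gameOp {n m : ℕ} (A : Matrix (Fin n) (Fin m) ℝ) (z : Profile n m) :
    Profile n m :=
  WithLp.toLp 2 (Sum.elim (A *ᵥ yPart z) (-(Aᵀ *ᵥ xPart z)))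

/-- The duality gap `Φ(x, y) = max_{y'} ⟨x, A y'⟩ - min_{x'} ⟨x', A y⟩`. -/
noncomputable def dualityGap {n m : ℕ} (A : Matrix (Fin n) (Fin m) ℝ) (z : Profile n m) : ℝ :=
  (⨆ y' : stdSimplex ℝ (Fin m), xPart z ⬝ᵥ (A *ᵥ (y' : Fin m → ℝ))) -
    ⨅ x' : stdSimplex ℝ (Fin n), (x' : Fin n → ℝ) ⬝ᵥ (A *ᵥ yPart z)

/-- `z` is an `ε`-equilibrium: a pair of mixed strategies with duality gap at most `ε`. -/
def IsEpsEquilibrium {n m : ℕ} (A : Matrix (Fin n) (Fin m) ℝ) (ε : ℝ) (z : Profile n m) : Prop :=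
  z ∈ feasible n m ∧ dualityGap A z ≤ ε

/-! ### Non-degenerate and support-stable games -/

/-- `(x, y)` is an equilibrium of the game in which `x` minimizes and `y` maximizes `⟨x, A y⟩`. -/
def IsEquilibrium {n m : ℕ} (A : Matrix (Fin n) (Fin m) ℝ) (x : Fin n → ℝ) (y : Fin m → ℝ) :
    Prop :=
  x ∈ stdSimplex ℝ (Fin n) ∧ y ∈ stdSimplex ℝ (Fin m) ∧
    (∀ x' ∈ stdSimplex ℝ (Fin n), x ⬝ᵥ (A *ᵥ y) ≤ x' ⬝ᵥ (A *ᵥ y)) ∧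
    (∀ y' ∈ stdSimplex ℝ (Fin m), x ⬝ᵥ (A *ᵥ y') ≤ x ⬝ᵥ (A *ᵥ y))

/-- The value `min_x max_y ⟨x, A y⟩` of the game. -/
noncomputable def value {n m : ℕ} (A : Matrix (Fin n) (Fin m) ℝ) : ℝ :=
  ⨅ x : stdSimplex ℝ (Fin n), ⨆ y : stdSimplex ℝ (Fin m),
    (x : Fin n → ℝ) ⬝ᵥ (A *ᵥ (y : Fin m → ℝ))

/-- The equilibrium is unique, and at it exactly `n` of the inequalities
`x_i ≥ 0`, `⟨x, A_{:,j}⟩ ≤ v` and exactly `m` of the inequalities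
`y_j ≥ 0`, `⟨y, A_{i,:}⟩ ≥ v` are tight. -/
def Nondegenerate {n m : ℕ} (A : Matrix (Fin n) (Fin m) ℝ) : Prop :=
  ∃ (x : Fin n → ℝ) (y : Fin m → ℝ),
    IsEquilibrium A x y ∧
    (∀ x' y', IsEquilibrium A x' y' → x' = x ∧ y' = y) ∧
    {i | x i = 0}.ncard + {j | x ⬝ᵥ A.col j = value A}.ncard = n ∧
    {j | y j = 0}.ncard + {i | y ⬝ᵥ A.row i = value A}.ncard = m

/-- Every perturbation of spectral norm at most `δ` keeps the game non-degenerate with the same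
equilibrium supports. -/
def SupportStable {n m : ℕ} (A : Matrix (Fin n) (Fin m) ℝ) (δ : ℝ) : Prop :=
  0 < δ ∧ Nondegenerate A ∧
    ∀ A' : Matrix (Fin n) (Fin m) ℝ, specNorm (A - A') ≤ δ →
      Nondegenerate A' ∧
      ∀ x y x' y', IsEquilibrium A x y → IsEquilibrium A' x' y' →
        (∀ i, 0 < x' i ↔ 0 < x i) ∧ (∀ j, 0 < y' j ↔ 0 < y j)

/-! ### The algorithms -/

/-- A minimizer of `f` over `K` (it is unique wherever it is used below). -/
noncomputable def argminOn {E : Type*} [Nonempty E] (f : E → ℝ) (K : Set E) : E :=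
  Classical.epsilon fun q => q ∈ K ∧ ∀ w ∈ K, f q ≤ f w

/-- Over a nonempty compact set a continuous function is minimized by `argminOn`. -/
theorem argminOn_spec {E : Type*} [TopologicalSpace E] [Nonempty E] {f : E → ℝ} {K : Set E}
    (hK : IsCompact K) (hne : K.Nonempty) (hf : ContinuousOn f K) :
    argminOn f K ∈ K ∧ ∀ w ∈ K, f (argminOn f K) ≤ f w := by
  obtain ⟨q, hq, hmin⟩ := hK.exists_isMinOn hne hf
  exact Classical.epsilon_spec (p := fun q => q ∈ K ∧ ∀ w ∈ K, f q ≤ f w)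
    ⟨q, hq, fun w hw => hmin hw⟩

/-- The Euclidean projection onto `Z`. -/
noncomputable def proj {n m : ℕ} (p : Profile n m) : Profile n m :=
  argminOn (fun q => ‖p - q‖) (feasible n m)

/-- `OGDA`: the pair `(z⁽ᵗ⁾, ẑ⁽ᵗ⁺¹⁾)`, with `z⁽⁰⁾ = ẑ⁽¹⁾ = z0`. -/
noncomputable def ogdaState {n m : ℕ} (A : Matrix (Fin n) (Fin m) ℝ) (η : ℝ) (z0 : Profile n m) :
    ℕ → Profile n m × Profile n m
  | 0 => (z0, z0)
  | t + 1 =>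
    let s := ogdaState A η z0 t
    let z' := proj (s.2 - η • gameOp A s.1)
    (z', proj (s.2 - η • gameOp A z'))

/-- The iterate of `OGDA` after `t` iterations. -/
noncomputable def ogda {n m : ℕ} (A : Matrix (Fin n) (Fin m) ℝ) (η : ℝ) (z0 : Profile n m)
    (t : ℕ) : Profile n m :=
  (ogdaState A η z0 t).1

/-- The iterate of `EGDA` after `t` iterations. -/
noncomputable def egda {n m : ℕ} (A : Matrix (Fin n) (Fin m) ℝ) (η : ℝ) (z0 : Profile n m) :
    ℕ → Profile n m
  | 0 => z0
  | t + 1 =>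
    let z := egda A η z0 t
    let zhat := proj (z - η • gameOp A z)
    proj (z - η • gameOp A zhat)

/-- The uniform profile `(1/n, …, 1/n, 1/m, …, 1/m)`. -/
noncomputable def uniformProfile (n m : ℕ) : Profile n m :=
  WithLp.toLp 2 (Sum.elim (fun _ => 1 / (n : ℝ)) (fun _ => 1 / (m : ℝ)))

/-- Nesterov's smoothed duality gap
`F_η(z) = max_{w ∈ Z} { ⟨F(z), z - w⟩ - (η / 2) ‖w - z̄‖² }`, with `z̄` the uniform profile. -/
noncomputable def smoothedGap {n m : ℕ} (A : Matrix (Fin n) (Fin m) ℝ) (η : ℝ)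
    (z : Profile n m) : ℝ :=
  ⨆ w : feasible n m,
    (inner ℝ (gameOp A z) (z - (w : Profile n m)) -
      η / 2 * ‖(w : Profile n m) - uniformProfile n m‖ ^ 2)

/-- The data kept by `Smoothing` at time `t`: the points `z⁽ᵗ⁾` and `ẑ⁽ᵗ⁾`, and the function
`w ↦ ∑_{τ < t} (τ + 1) / 2 * ⟨∇F_η(u_τ), w - u_τ⟩`. -/
structure SmoothingState (n m : ℕ) where
  z : Profile n m
  zhat : Profile n m
  model : Profile n m → ℝ

/-- The trajectory of `Smoothing` started at `z0`, with smoothing parameter `η` and norm `L`. -/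
noncomputable def smoothingState {n m : ℕ} (A : Matrix (Fin n) (Fin m) ℝ) (L η : ℝ)
    (z0 : Profile n m) : ℕ → SmoothingState n m
  | 0 => ⟨z0, z0, fun _ => 0⟩
  | t + 1 =>
    let s := smoothingState A L η z0 t
    let u := (2 / ((t : ℝ) + 2)) • s.zhat + ((t : ℝ) / ((t : ℝ) + 2)) • s.z
    let g := gradient (smoothedGap A η) u
    let model := fun w => s.model w + ((t : ℝ) + 1) / 2 * inner ℝ g (w - u)
    { z := argminOn (fun w => inner ℝ g (w - u) + L ^ 2 / (2 * η) * ‖w - u‖ ^ 2) (feasible n m)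
      zhat := argminOn (fun w => model w + L ^ 2 / (2 * η) * ‖w - z0‖ ^ 2) (feasible n m)
      model := model }

/-- The call `Smoothing(A, z0, ε)` (with norm `L` and smoothing parameter `ε / D_Z`, where `D_Z` is
the diameter of `Z`) returns `z` after exactly `N` iterations. -/
def SmoothingReturns {n m : ℕ} (A : Matrix (Fin n) (Fin m) ℝ) (L : ℝ) (z0 : Profile n m) (ε : ℝ)
    (N : ℕ) (z : Profile n m) : Prop :=
  let traj := smoothingState A L (ε / Metric.diam (feasible n m)) z0
  1 ≤ N ∧ z = (traj N).z ∧ dualityGap A z < ε ∧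
    ∀ k, 1 ≤ k → k < N → ¬ dualityGap A (traj k).z < ε

/-- `IterSmooth(A, z0, ρ, ε)` returns `zout` after exactly `K` iterations: it makes `T` successive
calls to `Smoothing`, the `t`-th from the point `z t`, with target accuracy
`tol (t + 1) = tol t / ρ`, where `tol 0 = Φ(z0)`, until the duality gap falls below `ε`.
The number `K` counts the iterations inside all the calls to `Smoothing`. -/
def IterSmoothReturns {n m : ℕ} (A : Matrix (Fin n) (Fin m) ℝ) (L : ℝ) (z0 : Profile n m)
    (ρ ε : ℝ) (K : ℕ) (zout : Profile n m) : Prop :=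
  ∃ (T : ℕ) (z : ℕ → Profile n m) (tol : ℕ → ℝ) (N : ℕ → ℕ),
    z 0 = z0 ∧ tol 0 = dualityGap A z0 ∧
    (∀ t < T, tol (t + 1) = tol t / ρ ∧
      SmoothingReturns A L (z t) (tol (t + 1)) (N t) (z (t + 1))) ∧
    1 ≤ T ∧ dualityGap A (z T) < ε ∧
    (∀ t, 1 ≤ t → t < T → ¬ dualityGap A (z t) < ε) ∧
    K = ∑ t ∈ Finset.range T, N t ∧ zout = z T

end ZeroSum

open scoped RealInnerProductSpace

namespace ZeroSum

section

/-! ### Variational inequalities in a Hilbert space -/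

section Generic

variable {E : Type*} [NormedAddCommGroup E] [InnerProductSpace ℝ E]

/-! The core is an error bound (`SupportStable.error_bound`): with P = n + m + M/δ and r = 10 P^10 /
M, a support-stable game has an equilibrium s with ‖z - s‖ ≤ r Φ(z) for all feasible z. Given this,
the usual analysis of each algorithm yields a linear rate.

The error bound comes from rank-one perturbations A - u wᵀ. Suppose a row outside the support of x
had tiny slack, or a positive y_j were tiny, or a strategy far from x were hardly exploitable. Then
an explicit small perturbation would have an equilibrium that is not strictly complementary, or
lacks a support element, or is not unique. Stability forbids all three (`RobustAt.lt_slack`,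
`RobustAt.one_le_mul_prob`, `RobustAt.coord_bound_of_support`). The other player is treated by
passing to -Aᵀ.

For EGDA and OGDA, `extragradient_step` makes a potential drop by a multiple of squared step
lengths. The gap after a projected step is at most a multiple of step lengths
(`dualityGap_proj_le`), so by the error bound the potential itself is controlled by the same squares
and contracts geometrically.

For IterSmooth, acceleration on the L²/η-smooth function F_η reaches gap ε within order L‖z⁽⁰⁾ -
s‖/ε iterations. Each call starts from gap at most ρ times its target, so the error bound makes this
ratio at most L r ρ, whatever the target. Only logarithmically many calls are needed. -/

theorem nonneg_of_forall_small_quadratic {X Y : ℝ}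
    (h : ∀ s : ℝ, 0 < s → s ≤ 1 → 0 ≤ s * X + s ^ 2 * Y) : 0 ≤ X := by
  by_contra! hX
  have hd : 0 < 2 * (|Y| + 1) - X := by have := abs_nonneg Y; linarith
  set s := -X / (2 * (|Y| + 1) - X) with hs
  have hs0 : 0 < s := div_pos (by linarith) hd
  have hs1 : s ≤ 1 := by
    rw [hs, div_le_one hd]; have := abs_nonneg Y; linarith
  have h1 := h s hs0 hs1
  have h2 : 0 ≤ X + s * Y := by
    by_contra! hc
    nlinarith
  have h3 : s * (2 * (|Y| + 1) - X) = -X := div_mul_cancel₀ _ hd.ne'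
  nlinarith [mul_le_mul_of_nonneg_left (le_abs_self Y) hs0.le, abs_nonneg Y,
    mul_nonneg hs0.le (abs_nonneg Y)]

/-- A minimizer over a convex set of an affine function plus a multiple of a squared distance
satisfies the quadratic growth inequality. -/
theorem quadratic_growth_of_min {K : Set E} (hK : Convex ℝ K) {c q p : E} {l : ℝ} (hq : q ∈ K)
    (hmin : ∀ w ∈ K, ⟪c, q⟫ + l / 2 * ‖q - p‖ ^ 2 ≤ ⟪c, w⟫ + l / 2 * ‖w - p‖ ^ 2)
    {w : E} (hw : w ∈ K) :
    ⟪c, q⟫ + l / 2 * ‖q - p‖ ^ 2 + l / 2 * ‖w - q‖ ^ 2 ≤ ⟪c, w⟫ + l / 2 * ‖w - p‖ ^ 2 := by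
  have key : ∀ s : ℝ, ⟪c, q + s • (w - q)⟫ + l / 2 * ‖q + s • (w - q) - p‖ ^ 2 =
      ⟪c, q⟫ + l / 2 * ‖q - p‖ ^ 2 + s * (⟪c, w - q⟫ + l * ⟪q - p, w - q⟫)
        + s ^ 2 * (l / 2 * ‖w - q‖ ^ 2) := by
    intro s
    rw [show q + s • (w - q) - p = (q - p) + s • (w - q) by abel, norm_add_sq_real,
      inner_add_right, inner_smul_right, inner_smul_right, norm_smul, mul_pow, Real.norm_eq_abs,
      sq_abs]
    ring
  -- First-order optimality along the segment from q to w; the exact quadratic expansion at s = 1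
  -- then leaves the growth term over.
  have h0 : 0 ≤ ⟪c, w - q⟫ + l * ⟪q - p, w - q⟫ := by
    refine nonneg_of_forall_small_quadratic (Y := l / 2 * ‖w - q‖ ^ 2) fun s hs0 hs1 => ?_
    have hmem : q + s • (w - q) ∈ K := hK.add_smul_sub_mem hq hw ⟨hs0.le, hs1⟩
    have := hmin _ hmem
    rw [key] at this
    linarith
  have h1 := key 1
  rw [one_smul, add_sub_cancel] at h1
  rw [h1]
  linarith

/-- The three-point inequality behind extragradient methods. -/
theorem extragradient_step {a b c s g h : E}
    (hb : ⟪a - g - b, c - b⟫ ≤ 0) (hc : ⟪a - h - c, s - c⟫ ≤ 0) :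
    ‖c - s‖ ^ 2 ≤ ‖a - s‖ ^ 2 - ‖a - b‖ ^ 2 - ‖b - c‖ ^ 2 - 2 * ⟪h, b - s⟫
      + 2 * (‖g - h‖ * ‖b - c‖) := by
  have hgh : ⟪h - g, b - c⟫ ≤ ‖g - h‖ * ‖b - c‖ := by
    rw [norm_sub_rev g h]; exact real_inner_le_norm _ _
  -- In terms of the consecutive differences a - b, b - c, c - s, everything becomes linear in inner
  -- products.
  obtain ⟨X, rfl⟩ : ∃ X, a = X + b := ⟨a - b, by abel⟩
  obtain ⟨Y, rfl⟩ : ∃ Y, b = Y + c := ⟨b - c, by abel⟩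
  obtain ⟨Z, rfl⟩ : ∃ Z, c = Z + s := ⟨c - s, by abel⟩
  have e1 : X + (Y + (Z + s)) - g - (Y + (Z + s)) = X - g := by abel
  have e2 : Z + s - (Y + (Z + s)) = -Y := by abel
  have e3 : X + (Y + (Z + s)) - h - (Z + s) = X + Y - h := by abel
  have e4 : s - (Z + s) = -Z := by abel
  have e5 : Z + s - s = Z := by abel
  have e6 : X + (Y + (Z + s)) - s = X + (Y + Z) := by abel
  have e7 : X + (Y + (Z + s)) - (Y + (Z + s)) = X := by abel
  have e8 : Y + (Z + s) - (Z + s) = Y := by abel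
  have e9 : Y + (Z + s) - s = Y + Z := by abel
  rw [e1, e2] at hb
  rw [e3, e4] at hc
  rw [e8] at hgh ⊢
  rw [e5, e6, e7, e9]
  rw [norm_add_sq_real, norm_add_sq_real]
  simp only [inner_sub_left, inner_add_left, inner_neg_right, inner_add_right] at *
  linarith

end Generic

/-! ### The feasible set and the game operator -/

variable {n m : ℕ}

theorem feasible_convex : Convex ℝ (feasible n m) := by
  intro z hz w hw a b ha hb hab
  exact ⟨convex_stdSimplex ℝ (Fin n) hz.1 hw.1 ha hb hab,
    convex_stdSimplex ℝ (Fin m) hz.2 hw.2 ha hb hab⟩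

theorem feasible_eq_preimage : feasible n m =
    (fun z : Profile n m => (xPart z, yPart z)) ⁻¹'
      (stdSimplex ℝ (Fin n) ×ˢ stdSimplex ℝ (Fin m)) := by
  ext z; rfl

theorem continuous_xPart : Continuous (xPart : Profile n m → Fin n → ℝ) := by
  unfold xPart; fun_prop

theorem continuous_yPart : Continuous (yPart : Profile n m → Fin m → ℝ) := by
  unfold yPart; fun_prop

theorem norm_sq_profile (z : Profile n m) :
    ‖z‖ ^ 2 = (∑ i, xPart z i ^ 2) + ∑ j, yPart z j ^ 2 := by
  rw [EuclideanSpace.norm_sq_eq, Fintype.sum_sum_type]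
  simp [xPart, yPart]

theorem sum_sq_sub_le {ι : Type*} [Fintype ι] {x x' : ι → ℝ} (hx : x ∈ stdSimplex ℝ ι)
    (hx' : x' ∈ stdSimplex ℝ ι) : ∑ i, (x i - x' i) ^ 2 ≤ 2 := by
  have h1 : ∀ i, (x i - x' i) ^ 2 ≤ x i + x' i := fun i => by
    have a1 := hx.1 i
    have a2 := hx'.1 i
    have b1 : x i ≤ 1 := hx.2 ▸ Finset.single_le_sum (fun k _ => hx.1 k) (Finset.mem_univ i)
    have b2 : x' i ≤ 1 := hx'.2 ▸ Finset.single_le_sum (fun k _ => hx'.1 k) (Finset.mem_univ i)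
    nlinarith
  calc ∑ i, (x i - x' i) ^ 2 ≤ ∑ i, (x i + x' i) := Finset.sum_le_sum fun i _ => h1 i
    _ = 2 := by rw [Finset.sum_add_distrib, hx.2, hx'.2]; norm_num

theorem sum_sq_le {ι : Type*} [Fintype ι] {x : ι → ℝ} (hx : x ∈ stdSimplex ℝ ι) :
    ∑ i, x i ^ 2 ≤ 1 := by
  have h1 : ∀ i, x i ^ 2 ≤ x i := fun i => by
    have a1 := hx.1 i
    have b1 : x i ≤ 1 := hx.2 ▸ Finset.single_le_sum (fun k _ => hx.1 k) (Finset.mem_univ i)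
    nlinarith
  exact (Finset.sum_le_sum fun i _ => h1 i).trans hx.2.le

theorem norm_sub_le_two {z w : Profile n m} (hz : z ∈ feasible n m) (hw : w ∈ feasible n m) :
    ‖z - w‖ ≤ 2 := by
  have h := norm_sq_profile (z - w)
  have h1 := sum_sq_sub_le hz.1 hw.1
  have h2 := sum_sq_sub_le hz.2 hw.2
  have e : ‖z - w‖ ^ 2 ≤ 2 ^ 2 := by
    rw [h]
    calc _ ≤ (2 : ℝ) + 2 := add_le_add h1 h2
      _ = 2 ^ 2 := by norm_num
  exact (sq_le_sq₀ (norm_nonneg _) (by norm_num)).mp e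

theorem norm_le_two {z : Profile n m} (hz : z ∈ feasible n m) : ‖z‖ ≤ 2 := by
  have h := norm_sq_profile z
  have h1 := sum_sq_le hz.1
  have h2 := sum_sq_le hz.2
  nlinarith [norm_nonneg z]

theorem feasible_isCompact : IsCompact (feasible n m) := by
  refine Metric.isCompact_of_isClosed_isBounded ?_ ?_
  · rw [feasible_eq_preimage]
    exact ((isClosed_stdSimplex ℝ (Fin n)).prod (isClosed_stdSimplex ℝ (Fin m))).preimage
      (continuous_xPart.prodMk continuous_yPart)
  · exact (Metric.isBounded_closedBall (x := (0 : Profile n m)) (r := 2)).subset fun z hz => by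
      simpa using norm_le_two hz

theorem proj_mem (hne : (feasible n m).Nonempty) (p : Profile n m) : proj p ∈ feasible n m :=
  (argminOn_spec feasible_isCompact hne (by fun_prop)).1

/-- Expanding ‖w - p‖² around the projection turns quadratic growth of the squared distance into the
obtuse-angle condition. -/
theorem inner_proj_le_zero (p : Profile n m) {w : Profile n m} (hw : w ∈ feasible n m) :
    ⟪p - proj p, w - proj p⟫ ≤ 0 := by
  have hs := argminOn_spec (f := fun q : Profile n m => ‖p - q‖) feasible_isCompact ⟨w, hw⟩
    (by fun_prop)
  have h := quadratic_growth_of_min (c := 0) (p := p) (l := 2) feasible_convex hs.1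
    (fun v hv => by
      have := hs.2 v hv
      rw [norm_sub_rev _ p, norm_sub_rev v p]
      simp only [inner_zero_left, zero_add]
      gcongr) hw
  change ⟪p - proj p, w - proj p⟫ ≤ 0
  change ⟪(0 : Profile n m), proj p⟫ + 2 / 2 * ‖proj p - p‖ ^ 2 + 2 / 2 * ‖w - proj p‖ ^ 2 ≤ _ at h
  have e : w - p = (w - proj p) - (p - proj p) := by abel
  rw [e, norm_sub_sq_real (w - proj p), norm_sub_rev (proj p) p, real_inner_comm (p - proj p) (w - proj p)] at h
  simp only [inner_zero_left] at h
  linarith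

theorem inner_gameOp (A : Matrix (Fin n) (Fin m) ℝ) (z w : Profile n m) :
    ⟪gameOp A z, w⟫ = xPart w ⬝ᵥ (A *ᵥ yPart z) - xPart z ⬝ᵥ (A *ᵥ yPart w) := by
  rw [PiLp.inner_apply, Fintype.sum_sum_type]
  have h2 : xPart z ⬝ᵥ (A *ᵥ yPart w) = yPart w ⬝ᵥ (Aᵀ *ᵥ xPart z) := by
    rw [Matrix.dotProduct_mulVec, Matrix.mulVec_transpose, dotProduct_comm]
  rw [h2]
  simp [gameOp, dotProduct, xPart, yPart, sub_eq_add_neg]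

/-- Source of the additivity and monotonicity of F, and of the convexity of the smoothed gap. -/
theorem gameOp_skew (A : Matrix (Fin n) (Fin m) ℝ) (z w : Profile n m) :
    ⟪gameOp A z, w⟫ = -⟪gameOp A w, z⟫ := by
  rw [inner_gameOp, inner_gameOp]; ring

theorem gameOp_self (A : Matrix (Fin n) (Fin m) ℝ) (z : Profile n m) : ⟪gameOp A z, z⟫ = 0 := by
  rw [inner_gameOp, sub_self]

theorem gameOp_sub (A : Matrix (Fin n) (Fin m) ℝ) (z w : Profile n m) :
    gameOp A (z - w) = gameOp A z - gameOp A w := by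
  refine ext_inner_right ℝ fun v => ?_
  rw [inner_sub_left, gameOp_skew, inner_sub_right, gameOp_skew A z, gameOp_skew A w]
  ring

/-- F acts blockwise by A and -Aᵀ, and Aᵀ inherits the bound of A from ‖Aᵀx‖² = ⟨x, A Aᵀ x⟩. -/
theorem norm_gameOp_le (A : Matrix (Fin n) (Fin m) ℝ) (z : Profile n m) :
    ‖gameOp A z‖ ≤ specNorm A * ‖z‖ := by
  have hA : ∀ y : Fin m → ℝ, ‖WithLp.toLp 2 (A *ᵥ y)‖ ≤ specNorm A * ‖WithLp.toLp 2 y‖ :=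
    fun y => (Matrix.toEuclideanLin A).toContinuousLinearMap.le_opNorm (WithLp.toLp 2 y)
  have hn : 0 ≤ specNorm A := norm_nonneg _
  have hAt : ∀ x : Fin n → ℝ, ‖WithLp.toLp 2 (Aᵀ *ᵥ x)‖ ≤ specNorm A * ‖WithLp.toLp 2 x‖ := by
    intro x
    set q := WithLp.toLp 2 (Aᵀ *ᵥ x) with hq
    have h1 : ‖q‖ ^ 2 = ⟪WithLp.toLp 2 x, WithLp.toLp 2 (A *ᵥ (Aᵀ *ᵥ x))⟫ := by
      rw [← real_inner_self_eq_norm_sq, hq, EuclideanSpace.inner_toLp_toLp,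
        EuclideanSpace.inner_toLp_toLp]
      simp only [star_trivial]
      conv_rhs => rw [dotProduct_comm, Matrix.dotProduct_mulVec, ← Matrix.mulVec_transpose]
    have h2 := real_inner_le_norm (WithLp.toLp 2 x) (WithLp.toLp 2 (A *ᵥ (Aᵀ *ᵥ x)))
    have h3 := hA (Aᵀ *ᵥ x)
    rw [← hq] at h3
    by_contra! hc
    have hx0 := norm_nonneg (WithLp.toLp 2 x)
    nlinarith [mul_nonneg hn hx0, mul_le_mul_of_nonneg_left h3 hx0]
  refine (sq_le_sq₀ (norm_nonneg _) (by positivity)).mp ?_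
  rw [norm_sq_profile, mul_pow, norm_sq_profile z]
  have h1 := hA (yPart z)
  have h2 := hAt (xPart z)
  have h1' := pow_le_pow_left₀ (norm_nonneg _) h1 2
  have h2' := pow_le_pow_left₀ (norm_nonneg _) h2 2
  rw [mul_pow, EuclideanSpace.norm_sq_eq, EuclideanSpace.norm_sq_eq] at h1' h2'
  simp only [Real.norm_eq_abs, sq_abs] at h1' h2'
  have e1 : ∑ i, xPart (gameOp A z) i ^ 2 = ∑ i, (A *ᵥ yPart z) i ^ 2 := rfl
  have e2 : ∑ i, yPart (gameOp A z) i ^ 2 = ∑ i, (Aᵀ *ᵥ xPart z) i ^ 2 := by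
    refine Finset.sum_congr rfl fun j _ => ?_
    have : yPart (gameOp A z) j = -(Aᵀ *ᵥ xPart z) j := rfl
    rw [this, neg_sq]
  rw [e1, e2]
  linarith

theorem norm_gameOp_sub_le {A : Matrix (Fin n) (Fin m) ℝ} {L : ℝ} (hL : specNorm A ≤ L)
    (z w : Profile n m) : ‖gameOp A z - gameOp A w‖ ≤ L * ‖z - w‖ := by
  rw [← gameOp_sub]
  exact (norm_gameOp_le A _).trans (by gcongr)

/-! ### The duality gap -/

theorem bddAbove_dot (c : Fin m → ℝ) :
    BddAbove (Set.range fun y : stdSimplex ℝ (Fin m) => c ⬝ᵥ (y : Fin m → ℝ)) := by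
  have h : IsCompact ((fun y : Fin m → ℝ => c ⬝ᵥ y) '' stdSimplex ℝ (Fin m)) :=
    (isCompact_stdSimplex ℝ (Fin m)).image (by unfold dotProduct; fun_prop)
  refine h.bddAbove.mono ?_
  rintro _ ⟨y, rfl⟩
  exact ⟨y, y.2, rfl⟩

theorem bddBelow_dot (c : Fin m → ℝ) :
    BddBelow (Set.range fun y : stdSimplex ℝ (Fin m) => (y : Fin m → ℝ) ⬝ᵥ c) := by
  have h : IsCompact ((fun y : Fin m → ℝ => y ⬝ᵥ c) '' stdSimplex ℝ (Fin m)) :=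
    (isCompact_stdSimplex ℝ (Fin m)).image (by unfold dotProduct; fun_prop)
  refine h.bddBelow.mono ?_
  rintro _ ⟨y, rfl⟩
  exact ⟨y, y.2, rfl⟩

theorem bddAbove_payoff (A : Matrix (Fin n) (Fin m) ℝ) (x : Fin n → ℝ) :
    BddAbove (Set.range fun y : stdSimplex ℝ (Fin m) => x ⬝ᵥ (A *ᵥ (y : Fin m → ℝ))) := by
  simp only [Matrix.dotProduct_mulVec]
  exact bddAbove_dot _

theorem inner_gameOp_sub (A : Matrix (Fin n) (Fin m) ℝ) (z w : Profile n m) :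
    ⟪gameOp A z, z - w⟫ = xPart z ⬝ᵥ (A *ᵥ yPart w) - xPart w ⬝ᵥ (A *ᵥ yPart z) := by
  rw [inner_sub_right, gameOp_self, inner_gameOp]; ring

/-- The duality gap is the support function of the variational inequality. -/
theorem dualityGap_le_iff {A : Matrix (Fin n) (Fin m) ℝ} {z : Profile n m}
    (hz : z ∈ feasible n m) {c : ℝ} :
    dualityGap A z ≤ c ↔ ∀ w ∈ feasible n m, ⟪gameOp A z, z - w⟫ ≤ c := by
  have : Nonempty (stdSimplex ℝ (Fin n)) := ⟨⟨_, hz.1⟩⟩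
  have : Nonempty (stdSimplex ℝ (Fin m)) := ⟨⟨_, hz.2⟩⟩
  have hA := bddAbove_payoff A (xPart z)
  have hB := bddBelow_dot (A *ᵥ yPart z)
  constructor
  · intro h w hw
    refine le_trans ?_ h
    rw [inner_gameOp_sub, dualityGap]
    exact sub_le_sub (le_ciSup hA ⟨_, hw.2⟩) (ciInf_le hB ⟨_, hw.1⟩)
  · intro h
    rw [dualityGap, sub_le_iff_le_add]
    refine ciSup_le fun y' => ?_
    rw [← sub_le_iff_le_add']
    refine le_ciInf fun x' => ?_
    have := h (WithLp.toLp 2 (Sum.elim (x' : Fin n → ℝ) (y' : Fin m → ℝ))) ⟨x'.2, y'.2⟩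
    rw [inner_gameOp_sub] at this
    change xPart z ⬝ᵥ (A *ᵥ (y' : Fin m → ℝ)) - (x' : Fin n → ℝ) ⬝ᵥ (A *ᵥ yPart z) ≤ c at this
    linarith

theorem inner_le_dualityGap (A : Matrix (Fin n) (Fin m) ℝ) {z w : Profile n m}
    (hz : z ∈ feasible n m) (hw : w ∈ feasible n m) :
    ⟪gameOp A z, z - w⟫ ≤ dualityGap A z :=
  (dualityGap_le_iff hz).mp le_rfl w hw

theorem dualityGap_nonneg (A : Matrix (Fin n) (Fin m) ℝ) {z : Profile n m}
    (hz : z ∈ feasible n m) : 0 ≤ dualityGap A z := by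
  simpa using inner_le_dualityGap A hz hz

end

/-! ### Equilibria, complementary slackness and non-degeneracy -/

section

section Simplex

variable {ι : Type*} [Fintype ι]

theorem le_dot_of_mem_stdSimplex {x c : ι → ℝ} {v : ℝ} (hx : x ∈ stdSimplex ℝ ι)
    (h : ∀ i, v ≤ c i) : v ≤ x ⬝ᵥ c := by
  calc v = ∑ i, x i * v := by rw [← Finset.sum_mul, hx.2, one_mul]
    _ ≤ x ⬝ᵥ c := Finset.sum_le_sum fun i _ => mul_le_mul_of_nonneg_left (h i) (hx.1 i)

theorem dot_le_of_mem_stdSimplex {x c : ι → ℝ} {v : ℝ} (hx : x ∈ stdSimplex ℝ ι)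
    (h : ∀ i, c i ≤ v) : x ⬝ᵥ c ≤ v := by
  calc x ⬝ᵥ c ≤ ∑ i, x i * v :=
        Finset.sum_le_sum fun i _ => mul_le_mul_of_nonneg_left (h i) (hx.1 i)
    _ = v := by rw [← Finset.sum_mul, hx.2, one_mul]

theorem abs_dot_le_of_mem_stdSimplex {x c : ι → ℝ} {v : ℝ} (hx : x ∈ stdSimplex ℝ ι)
    (h : ∀ i, |c i| ≤ v) : |x ⬝ᵥ c| ≤ v :=
  abs_le.mpr ⟨le_dot_of_mem_stdSimplex hx fun i => (abs_le.mp (h i)).1,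
    dot_le_of_mem_stdSimplex hx fun i => (abs_le.mp (h i)).2⟩

theorem le_one_of_mem_stdSimplex {x : ι → ℝ} (hx : x ∈ stdSimplex ℝ ι) (i : ι) : x i ≤ 1 :=
  hx.2 ▸ Finset.single_le_sum (fun k _ => hx.1 k) (Finset.mem_univ i)

theorem dot_sub_const {x c : ι → ℝ} (hx : x ∈ stdSimplex ℝ ι) (v : ℝ) :
    ∑ i, x i * (c i - v) = x ⬝ᵥ c - v := by
  simp only [mul_sub, Finset.sum_sub_distrib, ← Finset.sum_mul, hx.2, one_mul, dotProduct]

end Simplex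

variable {n m : ℕ} {A : Matrix (Fin n) (Fin m) ℝ}

theorem isEquilibrium_iff {x : Fin n → ℝ} {y : Fin m → ℝ} :
    IsEquilibrium A x y ↔ x ∈ stdSimplex ℝ (Fin n) ∧ y ∈ stdSimplex ℝ (Fin m) ∧
      (∀ i, x ⬝ᵥ (A *ᵥ y) ≤ (A *ᵥ y) i) ∧ ∀ j, (x ᵥ* A) j ≤ x ⬝ᵥ (A *ᵥ y) := by
  constructor
  · rintro ⟨hx, hy, h1, h2⟩
    refine ⟨hx, hy, fun i => ?_, fun j => ?_⟩
    · simpa using h1 _ (single_mem_stdSimplex ℝ i)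
    · have := h2 _ (single_mem_stdSimplex ℝ j)
      rwa [Matrix.dotProduct_mulVec, dotProduct_single, mul_one] at this
  · rintro ⟨hx, hy, h1, h2⟩
    refine ⟨hx, hy, fun x' hx' => le_dot_of_mem_stdSimplex hx' h1, fun y' hy' => ?_⟩
    rw [Matrix.dotProduct_mulVec, dotProduct_comm]
    exact dot_le_of_mem_stdSimplex hy' h2

/-- Weak duality as a certificate: this is how equilibria of all perturbed games below are
recognized. -/
theorem isEquilibrium_of_value {x : Fin n → ℝ} {y : Fin m → ℝ} {v : ℝ}
    (hx : x ∈ stdSimplex ℝ (Fin n)) (hy : y ∈ stdSimplex ℝ (Fin m))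
    (h1 : ∀ i, v ≤ (A *ᵥ y) i) (h2 : ∀ j, (x ᵥ* A) j ≤ v) :
    IsEquilibrium A x y ∧ x ⬝ᵥ (A *ᵥ y) = v := by
  have e : x ⬝ᵥ (A *ᵥ y) = v := by
    refine le_antisymm ?_ (le_dot_of_mem_stdSimplex hx h1)
    rw [Matrix.dotProduct_mulVec, dotProduct_comm]
    exact dot_le_of_mem_stdSimplex hy h2
  exact ⟨isEquilibrium_iff.mpr ⟨hx, hy, by rwa [e], by rwa [e]⟩, e⟩

theorem IsEquilibrium.neg_transpose {x : Fin n → ℝ} {y : Fin m → ℝ} (h : IsEquilibrium A x y) :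
    IsEquilibrium (-Aᵀ) y x := by
  rw [isEquilibrium_iff] at h
  obtain ⟨hx, hy, h1, h2⟩ := h
  refine (isEquilibrium_of_value (v := -(x ⬝ᵥ (A *ᵥ y))) hy hx (fun j => ?_) fun i => ?_).1
  · rw [Matrix.neg_mulVec, Matrix.mulVec_transpose]
    exact neg_le_neg (h2 j)
  · rw [Matrix.vecMul_neg, Matrix.vecMul_transpose]
    exact neg_le_neg (h1 i)

theorem IsEquilibrium.value_neg_transpose (A : Matrix (Fin n) (Fin m) ℝ) (x : Fin n → ℝ)
    (y : Fin m → ℝ) : y ⬝ᵥ (-Aᵀ *ᵥ x) = -(x ⬝ᵥ (A *ᵥ y)) := by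
  rw [Matrix.neg_mulVec, Matrix.mulVec_transpose, dotProduct_neg, dotProduct_comm,
    Matrix.dotProduct_mulVec]

/-- The nonnegative terms x_i ((Ay)_i - v) sum to zero, so each vanishes. -/
theorem IsEquilibrium.payoff_eq_of_ne_zero {x : Fin n → ℝ} {y : Fin m → ℝ}
    (h : IsEquilibrium A x y) {i : Fin n} (hi : x i ≠ 0) : (A *ᵥ y) i = x ⬝ᵥ (A *ᵥ y) := by
  obtain ⟨hx, hy, h1, h2⟩ := isEquilibrium_iff.mp h
  have h0 := dot_sub_const (c := A *ᵥ y) hx (x ⬝ᵥ (A *ᵥ y))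
  rw [sub_self, Finset.sum_eq_zero_iff_of_nonneg fun k _ =>
    mul_nonneg (hx.1 k) (sub_nonneg.mpr (h1 k))] at h0
  have := (mul_eq_zero.mp (h0 i (Finset.mem_univ i))).resolve_left hi
  linarith

theorem IsEquilibrium.payoff_eq_of_ne_zero' {x : Fin n → ℝ} {y : Fin m → ℝ}
    (h : IsEquilibrium A x y) {j : Fin m} (hj : y j ≠ 0) : (x ᵥ* A) j = x ⬝ᵥ (A *ᵥ y) := by
  have := h.neg_transpose.payoff_eq_of_ne_zero hj
  rw [IsEquilibrium.value_neg_transpose, Matrix.neg_mulVec, Matrix.mulVec_transpose] at this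
  exact neg_inj.mp this

theorem IsEquilibrium.value_eq {x : Fin n → ℝ} {y : Fin m → ℝ} (h : IsEquilibrium A x y) :
    value A = x ⬝ᵥ (A *ᵥ y) := by
  obtain ⟨hx, hy, h1, h2⟩ := h
  have : Nonempty (stdSimplex ℝ (Fin n)) := ⟨⟨_, hx⟩⟩
  have : Nonempty (stdSimplex ℝ (Fin m)) := ⟨⟨_, hy⟩⟩
  have hlow : ∀ x' : stdSimplex ℝ (Fin n), x ⬝ᵥ (A *ᵥ y) ≤
      ⨆ y' : stdSimplex ℝ (Fin m), (x' : Fin n → ℝ) ⬝ᵥ (A *ᵥ (y' : Fin m → ℝ)) := fun x' =>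
    (h1 x' x'.2).trans (le_ciSup (bddAbove_payoff A x') ⟨y, hy⟩)
  refine le_antisymm ?_ (le_ciInf hlow)
  refine (ciInf_le ⟨x ⬝ᵥ (A *ᵥ y), ?_⟩ ⟨x, hx⟩).trans (ciSup_le fun y' => h2 y' y'.2)
  rintro _ ⟨x', rfl⟩
  exact hlow x'

/-- Non-degeneracy implies strict complementarity. -/
theorem Nondegenerate.strict {x : Fin n → ℝ} {y : Fin m → ℝ} (hA : Nondegenerate A)
    (h : IsEquilibrium A x y) :
    (∀ i, x i = 0 → x ⬝ᵥ (A *ᵥ y) < (A *ᵥ y) i) ∧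
      ∀ j, y j = 0 → (x ᵥ* A) j < x ⬝ᵥ (A *ᵥ y) := by
  obtain ⟨x0, y0, -, huniq, hc1, hc2⟩ := hA
  obtain ⟨rfl, rfl⟩ := huniq x y h
  have hv := h.value_eq
  obtain ⟨hx, hy, h1, h2⟩ := isEquilibrium_iff.mp h
  have e1 : {j | x ⬝ᵥ A.col j = value A} = {j | (x ᵥ* A) j = x ⬝ᵥ (A *ᵥ y)} := by rw [hv]; rfl
  have e2 : {i | y ⬝ᵥ A.row i = value A} = {i | (A *ᵥ y) i = x ⬝ᵥ (A *ᵥ y)} := by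
    rw [hv]; ext i; rw [Set.mem_ofPred_eq, dotProduct_comm]; rfl
  rw [e1] at hc1
  rw [e2] at hc2
  have d1 := Set.ncard_add_ncard_compl {i | x i = 0}
  have d2 := Set.ncard_add_ncard_compl {j | y j = 0}
  rw [Nat.card_eq_fintype_card, Fintype.card_fin] at d1 d2
  -- Non-degeneracy says #(tight columns) = #supp x and #(tight rows) = #supp y. As supp x lies in
  -- the tight rows and supp y in the tight columns, all four cardinalities agree and both
  -- inclusions are equalities.
  have s1 : {i | x i = 0}ᶜ ⊆ {i | (A *ᵥ y) i = x ⬝ᵥ (A *ᵥ y)} := fun i hi =>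
    h.payoff_eq_of_ne_zero hi
  have s2 : {j | y j = 0}ᶜ ⊆ {j | (x ᵥ* A) j = x ⬝ᵥ (A *ᵥ y)} := fun j hj =>
    h.payoff_eq_of_ne_zero' hj
  have c1 := Set.ncard_le_ncard s1
  have c2 := Set.ncard_le_ncard s2
  have q1 := Set.eq_of_subset_of_ncard_le s1 (by omega)
  have q2 := Set.eq_of_subset_of_ncard_le s2 (by omega)
  constructor
  · intro i hi
    refine lt_of_le_of_ne (h1 i) fun he => ?_
    have : i ∈ {i | x i = 0}ᶜ := by rw [q1]; exact he.symm
    exact this hi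
  · intro j hj
    refine lt_of_le_of_ne (h2 j) fun he => ?_
    have : j ∈ {j | y j = 0}ᶜ := by rw [q2]; exact he
    exact this hj

/-! ### Entrywise stability and rank-one perturbations -/

theorem norm_le_sum_abs {ι : Type*} [Fintype ι] (z : EuclideanSpace ℝ ι) : ‖z‖ ≤ ∑ i, |z i| := by
  classical
  conv_lhs => rw [← (EuclideanSpace.basisFun ι ℝ).sum_repr z]
  refine (norm_sum_le _ _).trans (Finset.sum_le_sum fun i _ => ?_)
  rw [norm_smul, (EuclideanSpace.basisFun ι ℝ).norm_eq_one, mul_one]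
  rfl

theorem abs_apply_le_norm {ι : Type*} [Fintype ι] (z : EuclideanSpace ℝ ι) (i : ι) :
    |z i| ≤ ‖z‖ := by
  rw [← Real.norm_eq_abs]; exact PiLp.norm_apply_le z i

theorem specNorm_le_of_entry_le {e : ℝ} (h : ∀ i j, |A i j| ≤ e) : specNorm A ≤ n * m * e := by
  rcases n.eq_zero_or_pos with rfl | hn
  · have : A = 0 := Subsingleton.elim _ _
    simp [this, specNorm]
  rcases m.eq_zero_or_pos with rfl | hm
  · have : A = 0 := Subsingleton.elim _ _
    simp [this, specNorm]
  have he : 0 ≤ e := (abs_nonneg _).trans (h ⟨0, hn⟩ ⟨0, hm⟩)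
  refine ContinuousLinearMap.opNorm_le_bound _ (by positivity) fun y => ?_
  refine (norm_le_sum_abs _).trans ?_
  have : ∀ i, |(Matrix.toEuclideanLin A y) i| ≤ m * e * ‖y‖ := fun i => by
    change |∑ j, A i j * y j| ≤ _
    refine (Finset.abs_sum_le_sum_abs _ _).trans ?_
    calc ∑ j, |A i j * y j| ≤ ∑ _j : Fin m, e * ‖y‖ := Finset.sum_le_sum fun j _ => by
          rw [abs_mul]
          exact mul_le_mul (h i j) (abs_apply_le_norm y j) (abs_nonneg _) he
      _ = m * e * ‖y‖ := by simp; ring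
  calc ∑ i, |(Matrix.toEuclideanLin A y) i| ≤ ∑ _i : Fin n, m * e * ‖y‖ :=
        Finset.sum_le_sum fun i _ => this i
    _ = n * m * e * ‖y‖ := by simp; ring

/-- All games entrywise `e`-close to `A` have at most one equilibrium, which is strictly
complementary and has the supports of `(x, y)`. -/
def RobustAt (A : Matrix (Fin n) (Fin m) ℝ) (e : ℝ) (x : Fin n → ℝ) (y : Fin m → ℝ) : Prop :=
  ∀ A' : Matrix (Fin n) (Fin m) ℝ, (∀ i j, |A i j - A' i j| ≤ e) →
    ∀ x' y', IsEquilibrium A' x' y' →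
      (∀ x'' y'', IsEquilibrium A' x'' y'' → x'' = x' ∧ y'' = y') ∧
      (∀ i, x' i = 0 → x' ⬝ᵥ (A' *ᵥ y') < (A' *ᵥ y') i) ∧
      (∀ j, y' j = 0 → (x' ᵥ* A') j < x' ⬝ᵥ (A' *ᵥ y')) ∧
      (∀ i, x' i = 0 → x i = 0) ∧ ∀ j, y' j = 0 → y j = 0

/-- Passing from the spectral norm to entries costs a factor nm, but makes the size of u wᵀ
immediate. -/
theorem SupportStable.robustAt {d : ℝ} (h : SupportStable A d) {x : Fin n → ℝ} {y : Fin m → ℝ}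
    (hxy : IsEquilibrium A x y) (hn : 0 < n) (hm : 0 < m) : RobustAt A (d / (n * m)) x y := by
  intro A' hA' x' y' h'
  have hnm : (0 : ℝ) < n * m := by positivity
  obtain ⟨hnd, hs⟩ := h.2.2 A' (by
    refine (specNorm_le_of_entry_le (A := A - A') hA').trans ?_
    rw [mul_div_cancel₀ _ hnm.ne'])
  obtain ⟨sx, sy⟩ := hs x y x' y' hxy h'
  have hst := hnd.strict h'
  obtain ⟨x0, y0, -, huniq, -⟩ := hnd
  obtain ⟨rfl, rfl⟩ := huniq x' y' h'
  refine ⟨fun x'' y'' h'' => huniq x'' y'' h'', hst.1, hst.2, fun i hi => ?_, fun j hj => ?_⟩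
  · by_contra hne
    exact ((sx i).mpr (lt_of_le_of_ne (hxy.1.1 i) (Ne.symm hne))).ne' hi
  · by_contra hne
    exact ((sy j).mpr (lt_of_le_of_ne (hxy.2.1.1 j) (Ne.symm hne))).ne' hj

/-- Swapping the players, so that the bounds need proof for the minimizer only. -/
theorem RobustAt.neg_transpose {e : ℝ} {x : Fin n → ℝ} {y : Fin m → ℝ} (h : RobustAt A e x y) :
    RobustAt (-Aᵀ) e y x := by
  intro A' hA' y' x' h'
  obtain ⟨A'', rfl⟩ : ∃ A'' : Matrix (Fin n) (Fin m) ℝ, A' = -A''ᵀ := ⟨-A'ᵀ, by simp⟩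
  have back : ∀ x y, IsEquilibrium (-A''ᵀ) y x → IsEquilibrium A'' x y := fun x y hh => by
    simpa using hh.neg_transpose
  obtain ⟨h1, h2, h3, h4, h5⟩ := h A'' (fun i j => by
    have := hA' j i
    simp only [Matrix.neg_apply, Matrix.transpose_apply] at this
    rwa [neg_sub_neg, abs_sub_comm] at this) x' y' (back _ _ h')
  refine ⟨fun y2 x2 hh => (h1 x2 y2 (back _ _ hh)).symm, fun j hj => ?_, fun i hi => ?_, h5, h4⟩
  · rw [IsEquilibrium.value_neg_transpose, Matrix.neg_mulVec, Matrix.mulVec_transpose]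
    exact neg_lt_neg (h3 j hj)
  · rw [IsEquilibrium.value_neg_transpose, Matrix.vecMul_neg, Matrix.vecMul_transpose]
    exact neg_lt_neg (h2 i hi)

theorem sub_vecMulVec_mulVec (A : Matrix (Fin n) (Fin m) ℝ) (u : Fin n → ℝ) (w y : Fin m → ℝ)
    (i : Fin n) : ((A - Matrix.vecMulVec u w) *ᵥ y) i = (A *ᵥ y) i - u i * (w ⬝ᵥ y) := by
  rw [Matrix.sub_mulVec, Matrix.vecMulVec_mulVec]; simp [mul_comm]

theorem vecMul_sub_vecMulVec (A : Matrix (Fin n) (Fin m) ℝ) (u x : Fin n → ℝ) (w : Fin m → ℝ)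
    (j : Fin m) : (x ᵥ* (A - Matrix.vecMulVec u w)) j = (x ᵥ* A) j - (x ⬝ᵥ u) * w j := by
  rw [Matrix.vecMul_sub, Matrix.vecMul_vecMulVec]; simp

theorem abs_sub_sub_vecMulVec {u : Fin n → ℝ} {w : Fin m → ℝ} (i : Fin n) (j : Fin m) :
    |A i j - (A - Matrix.vecMulVec u w) i j| = |u i| * |w j| := by
  rw [Matrix.sub_apply, sub_sub_cancel, Matrix.vecMulVec_apply, abs_mul]

/-! ### The error bound -/

section Robust

variable {e M : ℝ} {x : Fin n → ℝ} {y : Fin m → ℝ}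

/-- Otherwise subtract the slack from row i. Since x puts no mass there, (x, y) remains an
equilibrium of the same value, now with row i unused but tight, against strict complementarity. -/
theorem RobustAt.lt_slack (hr : RobustAt A e x y) (hxy : IsEquilibrium A x y) {i : Fin n}
    (hi : x i = 0) : e < (A *ᵥ y) i - x ⬝ᵥ (A *ᵥ y) := by
  by_contra! hc
  obtain ⟨hx, hy, h1, h2⟩ := isEquilibrium_iff.mp hxy
  set v := x ⬝ᵥ (A *ᵥ y)
  set s := (A *ᵥ y) i - v with hs
  have hs0 : 0 ≤ s := sub_nonneg.mpr (h1 i)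
  set u : Fin n → ℝ := Pi.single i s with hu
  set A' := A - Matrix.vecMulVec u (fun _ : Fin m => (1 : ℝ)) with hA'
  have hw : (fun _ : Fin m => (1 : ℝ)) ⬝ᵥ y = 1 := by
    simp only [dotProduct, one_mul]; exact hy.2
  have hxu : x ⬝ᵥ u = 0 := by rw [hu, dotProduct_single, hi, zero_mul]
  have hAi : (A' *ᵥ y) i = v := by
    rw [hA', sub_vecMulVec_mulVec, hw, hu, Pi.single_eq_same, hs]; ring
  have heq := isEquilibrium_of_value (A := A') (v := v) hx hy
    (fun k => by
      rcases eq_or_ne k i with rfl | hk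
      · exact hAi.ge
      · rw [hA', sub_vecMulVec_mulVec, hu, Pi.single_eq_of_ne hk, zero_mul, sub_zero]
        exact h1 k)
    (fun j => by rw [hA', vecMul_sub_vecMulVec, hxu, zero_mul, sub_zero]; exact h2 j)
  obtain ⟨-, hst, -⟩ := hr A' (fun k j => by
    rw [hA', abs_sub_sub_vecMulVec, abs_one, mul_one, hu]
    rcases eq_or_ne k i with rfl | hk
    · rw [Pi.single_eq_same, abs_of_nonneg hs0]; exact hc
    · rw [Pi.single_eq_of_ne hk, abs_zero]; exact hs0.trans hc) x y heq.1
  have := hst i hi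
  rw [heq.2, hAi] at this
  exact this.false

theorem dot_payoff_le {x' : Fin n → ℝ} {v g : ℝ} (hy : y ∈ stdSimplex ℝ (Fin m))
    (hg : ∀ j, (x' ᵥ* A) j ≤ v + g) : x' ⬝ᵥ (A *ᵥ y) ≤ v + g := by
  rw [Matrix.dotProduct_mulVec, dotProduct_comm]
  exact dot_le_of_mem_stdSimplex hy hg

/-- The mass outside the equilibrium support is controlled by the exploitability. -/
theorem RobustAt.off_support_mass_le (hr : RobustAt A e x y) (hxy : IsEquilibrium A x y)
    {x' : Fin n → ℝ} (hx' : x' ∈ stdSimplex ℝ (Fin n)) {g : ℝ}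
    (hg : ∀ j, (x' ᵥ* A) j ≤ x ⬝ᵥ (A *ᵥ y) + g) :
    e * (∑ i, if x i = 0 then x' i else 0) ≤ g := by
  obtain ⟨hx, hy, h1, h2⟩ := isEquilibrium_iff.mp hxy
  have h3 := dot_payoff_le hy hg
  have h4 := dot_sub_const (c := A *ᵥ y) hx' (x ⬝ᵥ (A *ᵥ y))
  have h5 : e * (∑ i, if x i = 0 then x' i else 0) ≤
      ∑ i, x' i * ((A *ᵥ y) i - x ⬝ᵥ (A *ᵥ y)) := by
    rw [Finset.mul_sum]
    refine Finset.sum_le_sum fun i _ => ?_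
    split_ifs with hi
    · rw [mul_comm]
      exact mul_le_mul_of_nonneg_left (hr.lt_slack hxy hi).le (hx'.1 i)
    · rw [mul_zero]
      exact mul_nonneg (hx'.1 i) (sub_nonneg.mpr (h1 i))
  linarith

theorem abs_mulVec_le (hM : ∀ i j, |A i j| ≤ M) (hy : y ∈ stdSimplex ℝ (Fin m)) (i : Fin n) :
    |(A *ᵥ y) i| ≤ M := by
  change |A i ⬝ᵥ y| ≤ M
  rw [dotProduct_comm]
  exact abs_dot_le_of_mem_stdSimplex hy (hM i)

/-- Positive equilibrium probabilities of the maximizing player are bounded below. -/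
theorem RobustAt.one_le_mul_prob (hr : RobustAt A e x y) (he : 0 < e)
    (hM : ∀ i j, |A i j| ≤ M) (hxy : IsEquilibrium A x y) {j : Fin m} (hj : y j ≠ 0) :
    1 ≤ (2 + 4 * M / e) * y j := by
  obtain ⟨hx, hy, h1, h2⟩ := isEquilibrium_iff.mp hxy
  have hb : 0 < y j := lt_of_le_of_ne (hy.1 j) (Ne.symm hj)
  have hn : Nonempty (Fin n) := by
    by_contra hne
    rw [not_nonempty_iff] at hne
    have := hx.2
    simp at this
  have hM0 : 0 ≤ M := (abs_nonneg _).trans (hM hn.some j)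
  -- If b = y_j is too small, delete j from y and renormalize. The resulting y' is an equilibrium
  -- strategy of a nearby game, with a support that stability forbids.
  by_contra! hc
  have hq : 0 ≤ 4 * M / e * y j := by positivity
  have hb2 : y j < 1 / 2 := by linarith
  have hMb : 4 * M * y j ≤ e := by
    have : 4 * M / e * y j ≤ 1 := by linarith
    rw [div_mul_eq_mul_div, div_le_one he] at this
    exact this
  set b := y j with hbdef
  have h1b : 0 < 1 - b := by linarith
  set v := x ⬝ᵥ (A *ᵥ y) with hv
  set y' : Fin m → ℝ := fun k => (y k - (Pi.single j b : Fin m → ℝ) k) / (1 - b) with hy'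
  have hy'j : y' j = 0 := by simp [hy', hbdef]
  have hy'mem : y' ∈ stdSimplex ℝ (Fin m) := by
    constructor
    · intro k
      rcases eq_or_ne k j with rfl | hk
      · rw [hy'j]
      · simp only [hy', Pi.single_eq_of_ne hk, sub_zero]
        exact div_nonneg (hy.1 k) h1b.le
    · simp only [hy']
      rw [← Finset.sum_div, Finset.sum_sub_distrib, hy.2, Finset.sum_pi_single']
      simp [h1b.ne']
  have hxy' : x ⬝ᵥ (A *ᵥ y') = v := by
    rw [Matrix.dotProduct_mulVec, dotProduct_comm]
    have := dot_sub_const (c := x ᵥ* A) hy'mem v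
    rw [Finset.sum_eq_zero] at this
    · linarith
    · intro k _
      rcases eq_or_ne (y k) 0 with hk | hk
      · have : y' k = 0 := by
          simp only [hy', hk]
          rw [Pi.single_eq_of_ne (by rintro rfl; exact hj hk)]; simp
        rw [this, zero_mul]
      · rw [hxy.payoff_eq_of_ne_zero' hk, sub_self, mul_zero]
  -- Subtracting u from every column gives A'y' = Ay. Since x is indifferent on supp y, x ⬝ u = 0
  -- and the column payoffs of x do not change. Moreover u_i = b ((Ay')_i - A_ij) is at most 2Mb ≤ e
  -- in absolute value.
  set u : Fin n → ℝ := fun i => (A *ᵥ y') i - (A *ᵥ y) i with hu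
  have hAy' : ∀ i, (1 - b) * (A *ᵥ y') i = (A *ᵥ y) i - b * A i j := by
    intro i
    have e1 : y = (1 - b) • y' + Pi.single j b := by
      funext k
      simp only [hy', Pi.add_apply, Pi.smul_apply, smul_eq_mul]
      field_simp
      ring
    have e2 : (A *ᵥ y) i = (1 - b) * (A *ᵥ y') i + b * A i j := by
      conv_lhs => rw [e1]
      rw [Matrix.mulVec_add, Matrix.mulVec_smul, Matrix.mulVec_single]
      simp [mul_comm]
    linarith
  have hub : ∀ i, |u i| ≤ e := by
    intro i
    have e1 : u i = b * ((A *ᵥ y') i - A i j) := by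
      simp only [hu]; have := hAy' i; linarith
    have a1 := abs_mulVec_le hM hy'mem i
    have a2 := hM i j
    have a3 : |(A *ᵥ y') i - A i j| ≤ M + M := (abs_sub _ _).trans (add_le_add a1 a2)
    rw [e1, abs_mul, abs_of_pos hb]
    nlinarith
  set A' := A - Matrix.vecMulVec u (fun _ : Fin m => (1 : ℝ)) with hA'
  have hw : (fun _ : Fin m => (1 : ℝ)) ⬝ᵥ y' = 1 := by
    simp only [dotProduct, one_mul]; exact hy'mem.2
  have hxu : x ⬝ᵥ u = 0 := by
    have : u = A *ᵥ y' - A *ᵥ y := rfl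
    rw [this, dotProduct_sub, hxy', sub_self]
  have heq := isEquilibrium_of_value (A := A') (v := v) hx hy'mem
    (fun i => by
      rw [hA', sub_vecMulVec_mulVec, hw, mul_one, hu]
      simpa using h1 i)
    (fun k => by rw [hA', vecMul_sub_vecMulVec, hxu, zero_mul, sub_zero]; exact h2 k)
  obtain ⟨-, -, -, -, hs⟩ := hr A' (fun i k => by
    rw [hA', abs_sub_sub_vecMulVec, abs_one, mul_one]; exact hub i) x y' heq.1
  exact hj (hs j hy'j)

/-- Error bound for strategies supported in the equilibrium support. -/
theorem RobustAt.coord_bound_of_support (hr : RobustAt A e x y)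
    (hxy : IsEquilibrium A x y) {B : ℝ} (hB1 : 1 ≤ B) (hB : ∀ j, y j ≠ 0 → 1 ≤ B * y j)
    {x' : Fin n → ℝ} (hx' : x' ∈ stdSimplex ℝ (Fin n)) (hsupp : ∀ i, x i = 0 → x' i = 0) {g : ℝ}
    (hg : ∀ j, (x' ᵥ* A) j ≤ x ⬝ᵥ (A *ᵥ y) + g) (a : Fin n) :
    e * |x' a - x a| ≤ B * g := by
  obtain ⟨hx, hy, h1, h2⟩ := isEquilibrium_iff.mp hxy
  set v := x ⬝ᵥ (A *ᵥ y) with hv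
  set r : Fin m → ℝ := fun j => (x' ᵥ* A) j - v with hrdef
  have hxv : x' ⬝ᵥ (A *ᵥ y) = v := by
    have := dot_sub_const (c := A *ᵥ y) hx' v
    rw [Finset.sum_eq_zero] at this
    · linarith
    · intro i _
      rcases eq_or_ne (x i) 0 with hi | hi
      · rw [hsupp i hi, zero_mul]
      · rw [hxy.payoff_eq_of_ne_zero hi, sub_self, mul_zero]
  have hg0 : 0 ≤ g := by have := dot_payoff_le hy hg; linarith
  have hry : ∑ j, y j * r j = 0 := by
    simp only [hrdef]
    rw [dot_sub_const hy, dotProduct_comm, ← Matrix.dotProduct_mulVec, hxv, sub_self]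
  have hrg : ∀ j, r j ≤ g := fun j => by simp only [hrdef]; linarith [hg j]
  -- If x' is too far from x, both become equilibrium strategies of A - u wᵀ, against uniqueness.
  -- The vector u pairs to 0 with x and to 1 with x', and w absorbs the excess payoffs r of x'.
  by_contra! hc
  have hd : x' a - x a ≠ 0 := by
    intro h0
    rw [h0, abs_zero, mul_zero] at hc
    nlinarith
  have hdp : 0 < |x' a - x a| := abs_pos.mpr hd
  set u : Fin n → ℝ := fun i => ((Pi.single a 1 : Fin n → ℝ) i - x a) / (x' a - x a) with hu
  -- Truncating off supp y keeps w ≥ r and w ⬝ y = 0 while removing entries of r that have no lower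
  -- bound in terms of g.
  set w : Fin m → ℝ := fun j => if y j = 0 then max (r j) 0 else r j with hw
  have hdot : ∀ p ∈ stdSimplex ℝ (Fin n), p ⬝ᵥ u = (p a - x a) / (x' a - x a) := by
    intro p hp
    have : p ⬝ᵥ u = (∑ i, (p i * (Pi.single a 1 : Fin n → ℝ) i - p i * x a)) / (x' a - x a) := by
      rw [Finset.sum_div]
      refine Finset.sum_congr rfl fun i _ => ?_
      simp only [hu]; ring
    rw [this, Finset.sum_sub_distrib, ← Finset.sum_mul, hp.2, one_mul]
    congr 2
    exact (dotProduct_single p (1 : ℝ) a).trans (mul_one _)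
  have hxu : x ⬝ᵥ u = 0 := by rw [hdot x hx, sub_self, zero_div]
  have hxu' : x' ⬝ᵥ u = 1 := by rw [hdot x' hx', div_self hd]
  have hwy : w ⬝ᵥ y = 0 := by
    rw [← hry]
    refine Finset.sum_congr rfl fun j _ => ?_
    simp only [hw]
    split_ifs with hj
    · rw [hj]; ring
    · ring
  have hwr : ∀ j, r j ≤ w j := fun j => by
    simp only [hw]; split_ifs
    · exact le_max_left _ _
    · exact le_rfl
  have hwb : ∀ j, |w j| ≤ B * g := by
    intro j
    have hgB : g ≤ B * g := le_mul_of_one_le_left hg0 hB1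
    simp only [hw]
    split_ifs with hj
    · rw [abs_of_nonneg (le_max_right _ _)]
      exact (max_le (hrg j) hg0).trans hgB
    · rw [abs_le]
      refine ⟨?_, (hrg j).trans hgB⟩
      have hyj : 0 < y j := lt_of_le_of_ne (hy.1 j) (Ne.symm hj)
      -- The y-average of g - r is g, so g - r_j ≤ g / y_j ≤ B g bounds r_j from below.
      have e1 : y j * (g - r j) ≤ ∑ k, y k * (g - r k) :=
        Finset.single_le_sum (f := fun k => y k * (g - r k))
          (fun k _ => mul_nonneg (hy.1 k) (sub_nonneg.mpr (hrg k))) (Finset.mem_univ j)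
      have e2 : ∑ k, y k * (g - r k) = g := by
        simp only [mul_sub, Finset.sum_sub_distrib, hry, ← Finset.sum_mul, hy.2]
        ring
      have := hB j hj
      nlinarith
  have hub : ∀ i, |u i| ≤ 1 / |x' a - x a| := by
    intro i
    simp only [hu]
    rw [abs_div]
    gcongr
    have b1 := hx.1 a
    have b2 := le_one_of_mem_stdSimplex hx a
    rcases eq_or_ne i a with rfl | hi
    · rw [Pi.single_eq_same, abs_le]; constructor <;> linarith
    · rw [Pi.single_eq_of_ne hi, abs_le]; constructor <;> linarith
  set A' := A - Matrix.vecMulVec u w with hA'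
  have hAy : ∀ i, v ≤ (A' *ᵥ y) i := fun i => by
    rw [hA', sub_vecMulVec_mulVec, hwy, mul_zero, sub_zero]; exact h1 i
  have heq := isEquilibrium_of_value (A := A') (v := v) hx hy hAy fun j => by
    rw [hA', vecMul_sub_vecMulVec, hxu, zero_mul, sub_zero]; exact h2 j
  have heq' := isEquilibrium_of_value (A := A') (v := v) hx' hy hAy fun j => by
    rw [hA', vecMul_sub_vecMulVec, hxu', one_mul]
    have := hwr j
    simp only [hrdef] at this
    linarith
  obtain ⟨huniq, -⟩ := hr A' (fun i j => by
    rw [hA', abs_sub_sub_vecMulVec]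
    calc |u i| * |w j| ≤ 1 / |x' a - x a| * (B * g) :=
          mul_le_mul (hub i) (hwb j) (abs_nonneg _) (by positivity)
      _ ≤ e := by rw [one_div_mul_eq_div, div_le_iff₀ hdp]; exact hc.le) x y heq.1
  exact hd (sub_eq_zero.mpr (congrFun (huniq x' y heq'.1).1 a))

/-- Coordinatewise error bound for the minimizing player. -/
theorem RobustAt.coord_bound (hr : RobustAt A e x y) (he : 0 < e) (hM : ∀ i j, |A i j| ≤ M)
    (hM0 : 0 ≤ M) (hxy : IsEquilibrium A x y) {x' : Fin n → ℝ}
    (hx' : x' ∈ stdSimplex ℝ (Fin n)) {g : ℝ}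
    (hg : ∀ j, (x' ᵥ* A) j ≤ x ⬝ᵥ (A *ᵥ y) + g) (a : Fin n) :
    |x' a - x a| ≤ ((2 + 4 * M / e) * (1 + 2 * M / e) + 1) * (g / e) := by
  obtain ⟨hx, hy, h1, h2⟩ := isEquilibrium_iff.mp hxy
  set mu := ∑ i, if x i = 0 then x' i else 0 with hmu
  have hterm : ∀ i, 0 ≤ if x i = 0 then x' i else 0 := fun i => by
    split_ifs
    · exact hx'.1 i
    · exact le_rfl
  have hmu0 : 0 ≤ mu := Finset.sum_nonneg fun i _ => hterm i
  have hmug : mu ≤ g / e := by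
    rw [le_div_iff₀ he, mul_comm]; exact hr.off_support_mass_le hxy hx' hg
  -- The off-support mass mu ≤ g/e is redistributed according to x. This raises each column payoff
  -- by at most 2M mu, and the supported case applies to z.
  set z : Fin n → ℝ := fun i => (if x i = 0 then 0 else x' i) + mu * x i with hz
  have hdiff : ∀ i, z i - x' i = mu * x i - if x i = 0 then x' i else 0 := fun i => by
    simp only [hz]; split_ifs <;> ring
  have hzmem : z ∈ stdSimplex ℝ (Fin n) := by
    constructor
    · intro i
      refine add_nonneg ?_ (mul_nonneg hmu0 (hx.1 i))
      split_ifs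
      · exact le_rfl
      · exact hx'.1 i
    · have : ∑ i, (z i - x' i) = 0 := by
        simp only [hdiff, Finset.sum_sub_distrib, ← Finset.mul_sum, hx.2, mul_one]
        exact sub_self _
      rw [Finset.sum_sub_distrib, hx'.2] at this
      linarith
  have hzs : ∀ i, x i = 0 → z i = 0 := fun i hi => by simp [hz, hi]
  have hzg : ∀ j, (z ᵥ* A) j ≤ x ⬝ᵥ (A *ᵥ y) + (g + 2 * M * mu) := by
    intro j
    have e1 : (z ᵥ* A) j - (x' ᵥ* A) j = ∑ i, (z i - x' i) * A i j := by
      simp only [Matrix.vecMul, dotProduct, sub_mul, Finset.sum_sub_distrib]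
    have e2 : ∑ i, (z i - x' i) * A i j ≤ ∑ i, (mu * x i + if x i = 0 then x' i else 0) * M := by
      refine Finset.sum_le_sum fun i _ => ?_
      have a0 := mul_nonneg hmu0 (hx.1 i)
      have a1 := hterm i
      have a2 := abs_le.mp (hM i j)
      rw [hdiff]
      nlinarith
    rw [← Finset.sum_mul, Finset.sum_add_distrib, ← Finset.mul_sum, hx.2] at e2
    have := hg j
    rw [← hmu] at e2
    linarith
  have hB : (1 : ℝ) ≤ 2 + 4 * M / e := by
    have : 0 ≤ 4 * M / e := by positivity
    linarith
  have h3 := hr.coord_bound_of_support hxy hB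
    (fun j hj => hr.one_le_mul_prob he hM hxy hj) hzmem hzs hzg a
  have h4 : |x' a - z a| ≤ mu := by
    have a1 := hterm a
    have a2 : (if x a = 0 then x' a else 0) ≤ mu :=
      Finset.single_le_sum (f := fun i => if x i = 0 then x' i else 0) (fun i _ => hterm i)
        (Finset.mem_univ a)
    have a3 := mul_nonneg hmu0 (hx.1 a)
    have a4 := mul_le_of_le_one_right hmu0 (le_one_of_mem_stdSimplex hx a)
    rw [abs_sub_comm, hdiff, abs_le]
    constructor <;> linarith
  have h5 : |z a - x a| ≤ (2 + 4 * M / e) * (g + 2 * M * mu) / e := by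
    rw [le_div_iff₀ he]; linarith
  have h6 : (2 + 4 * M / e) * (g + 2 * M * mu) / e ≤
      (2 + 4 * M / e) * (1 + 2 * M / e) * (g / e) := by
    rw [show (2 + 4 * M / e) * (1 + 2 * M / e) * (g / e) =
      (2 + 4 * M / e) * (g + 2 * M * (g / e)) / e by field_simp]
    gcongr
  calc |x' a - x a| = |(x' a - z a) + (z a - x a)| := by rw [sub_add_sub_cancel]
    _ ≤ |x' a - z a| + |z a - x a| := abs_add_le _ _
    _ ≤ ((2 + 4 * M / e) * (1 + 2 * M / e) + 1) * (g / e) := by linarith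

end Robust

/-- The number by which the duality gap controls the distance to the equilibrium is polynomial in
`n + m + M / δ`. -/
theorem SupportStable.error_bound {M d : ℝ} (h : SupportStable A d) (hM0 : 0 < M)
    (hM : ∀ i j, |A i j| ≤ M) :
    ∃ s ∈ feasible n m, (∀ w ∈ feasible n m, ⟪gameOp A s, s - w⟫ ≤ 0) ∧
      ∀ z ∈ feasible n m, ‖z - s‖ ≤ 10 * (n + m + M / d) ^ 10 / M * dualityGap A z := by
  obtain ⟨x, y, hxy, -⟩ := h.2.1
  obtain ⟨hx, hy, h1, h2⟩ := isEquilibrium_iff.mp hxy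
  have hn : 0 < n := by
    rcases n.eq_zero_or_pos with rfl | hn
    · have := hx.2
      simp at this
    · exact hn
  have hm : 0 < m := by
    rcases m.eq_zero_or_pos with rfl | hm
    · have := hy.2
      simp at this
    · exact hm
  have hd := h.1
  have hn1 : (1 : ℝ) ≤ n := by exact_mod_cast hn
  have hm1 : (1 : ℝ) ≤ m := by exact_mod_cast hm
  have he : 0 < d / (n * m) := by positivity
  have hr := h.robustAt hxy hn hm
  set s : Profile n m := WithLp.toLp 2 (Sum.elim x y) with hs
  have hsf : s ∈ feasible n m := ⟨hx, hy⟩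
  refine ⟨s, hsf, fun w hw => ?_, fun z hz => ?_⟩
  · rw [inner_gameOp_sub]
    change x ⬝ᵥ (A *ᵥ yPart w) - xPart w ⬝ᵥ (A *ᵥ y) ≤ 0
    have a1 := hxy.2.2.1 _ hw.1
    have a2 := hxy.2.2.2 _ hw.2
    linarith
  set g := dualityGap A z with hgdef
  have hg0 : 0 ≤ g := dualityGap_nonneg A hz
  set v := x ⬝ᵥ (A *ᵥ y) with hv
  set K := ((2 + 4 * M / (d / (n * m))) * (1 + 2 * M / (d / (n * m))) + 1) * (g / (d / (n * m)))
    with hK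
  have hxb : ∀ a, |xPart z a - x a| ≤ K := by
    refine hr.coord_bound he hM hM0.le hxy hz.1 fun j => ?_
    -- Testing the gap against (x, e_j) bounds the payoff of column j, because x guarantees at most
    -- v against the second part of z.
    have hw : (WithLp.toLp 2 (Sum.elim x (Pi.single j 1)) : Profile n m) ∈ feasible n m :=
      ⟨hx, single_mem_stdSimplex ℝ j⟩
    have := inner_le_dualityGap A hz hw
    rw [inner_gameOp_sub] at this
    change xPart z ⬝ᵥ (A *ᵥ (Pi.single j 1 : Fin m → ℝ)) - x ⬝ᵥ (A *ᵥ yPart z) ≤ g at this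
    rw [Matrix.dotProduct_mulVec, dotProduct_single, mul_one] at this
    have := hxy.2.2.2 _ hz.2
    linarith
  have hyb : ∀ a, |yPart z a - y a| ≤ K := by
    refine hr.neg_transpose.coord_bound he (fun j i => ?_) hM0.le hxy.neg_transpose hz.2
      fun i => ?_
    · rw [Matrix.neg_apply, abs_neg]; exact hM i j
    have hw : (WithLp.toLp 2 (Sum.elim (Pi.single i 1) y) : Profile n m) ∈ feasible n m :=
      ⟨single_mem_stdSimplex ℝ i, hy⟩
    have := inner_le_dualityGap A hz hw
    rw [inner_gameOp_sub] at this
    change xPart z ⬝ᵥ (A *ᵥ y) - (Pi.single i 1 : Fin n → ℝ) ⬝ᵥ (A *ᵥ yPart z) ≤ g at this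
    rw [single_dotProduct, one_mul] at this
    have := hxy.2.2.1 _ hz.1
    rw [IsEquilibrium.value_neg_transpose, Matrix.vecMul_neg, Matrix.vecMul_transpose]
    change -((A *ᵥ yPart z) i) ≤ _
    linarith
  have hsum : ‖z - s‖ ≤ (n + m) * K := by
    refine (norm_le_sum_abs _).trans ?_
    rw [Fintype.sum_sum_type]
    calc _ ≤ (∑ _i : Fin n, K) + ∑ _j : Fin m, K :=
          add_le_add (Finset.sum_le_sum fun i _ => hxb i) (Finset.sum_le_sum fun j _ => hyb j)
      _ = (n + m) * K := by simp; ring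
  refine hsum.trans ?_
  set p := M / d with hp
  have hp0 : 0 < p := by positivity
  set P := n + m + p with hP
  -- M/e is at most P³ and K · M/g is cubic in it, which gives P⁹; summing over n + m coordinates
  -- adds the last power. The factor 10 absorbs lower-order terms since P³ ≥ 8.
  have hq : M / (d / (n * m)) = n * m * p := by rw [hp]; field_simp
  have hKq : K = ((2 + 4 * (n * m * p)) * (1 + 2 * (n * m * p)) + 1) * (n * m * p) * (g / M) := by
    rw [hK, mul_div_assoc, mul_div_assoc, hq]
    have : g / (d / (n * m)) = (n * m * p) * (g / M) := by rw [← hq]; field_simp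
    rw [this]; ring
  have hP2 : 2 ≤ P := by rw [hP]; linarith
  have hqP : n * m * p ≤ P ^ 3 := by
    calc (n : ℝ) * m * p ≤ P * P * P := by gcongr <;> rw [hP] <;> linarith
      _ = P ^ 3 := by ring
  have hP3 : 8 ≤ P ^ 3 := by
    calc (8 : ℝ) = 2 ^ 3 := by norm_num
      _ ≤ P ^ 3 := by gcongr
  set Q := P ^ 3 with hQ
  have hK2 : K ≤ 10 * Q ^ 3 * (g / M) := by
    rw [hKq]
    refine mul_le_mul_of_nonneg_right ?_ (by positivity)
    calc ((2 + 4 * (n * m * p)) * (1 + 2 * (n * m * p)) + 1) * (n * m * p)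
        ≤ ((2 + 4 * Q) * (1 + 2 * Q) + 1) * Q := by gcongr
      _ ≤ 10 * Q ^ 3 := by nlinarith [mul_nonneg (show 0 ≤ Q by linarith) (show 0 ≤ Q by linarith)]
  calc (n + m) * K ≤ P * (10 * Q ^ 3 * (g / M)) := by gcongr; rw [hP]; linarith
    _ = 10 * P ^ 10 / M * g := by rw [hQ]; ring

end

/-! ### Linear convergence of EGDA and OGDA -/

section

variable {n m : ℕ} {A : Matrix (Fin n) (Fin m) ℝ} {L r : ℝ} {s : Profile n m}

/-- The Minty form of the variational inequality, which lets the inner product in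
`extragradient_step` be dropped. -/
theorem inner_gameOp_sub_nonneg (hs : ∀ w ∈ feasible n m, ⟪gameOp A s, s - w⟫ ≤ 0)
    {z : Profile n m} (hz : z ∈ feasible n m) : 0 ≤ ⟪gameOp A z, z - s⟫ := by
  have h := hs z hz
  rw [inner_sub_right, gameOp_self] at h ⊢
  rw [gameOp_skew]
  linarith

/-- The duality gap is Lipschitz around an equilibrium. -/
theorem dualityGap_le_dist (hL0 : 0 ≤ L) (hL : specNorm A ≤ L) (hsf : s ∈ feasible n m)
    (hs : ∀ w ∈ feasible n m, ⟪gameOp A s, s - w⟫ ≤ 0) {z : Profile n m}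
    (hz : z ∈ feasible n m) : dualityGap A z ≤ 4 * L * ‖z - s‖ := by
  refine (dualityGap_le_iff hz).mpr fun w hw => ?_
  have e : ⟪gameOp A z, z - w⟫ = ⟪gameOp A z - gameOp A s, z - w⟫ + ⟪gameOp A s, z - s⟫
      + ⟪gameOp A s, s - w⟫ := by
    simp only [inner_sub_left, inner_sub_right]; ring
  have h1 := real_inner_le_norm (gameOp A z - gameOp A s) (z - w)
  have h2 := real_inner_le_norm (gameOp A s) (z - s)
  have h3 := norm_gameOp_sub_le hL z s
  have h4 := norm_gameOp_le A s
  have h5 := norm_sub_le_two hz hw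
  have h6 := norm_le_two hsf
  have h7 := hs w hw
  have h8 := norm_nonneg (z - s)
  have h9 : ‖gameOp A z - gameOp A s‖ * ‖z - w‖ ≤ L * ‖z - s‖ * 2 :=
    mul_le_mul h3 h5 (norm_nonneg _) (by positivity)
  have h10 : ‖gameOp A s‖ ≤ L * 2 :=
    h4.trans (mul_le_mul hL h6 (norm_nonneg _) hL0)
  have h11 : ‖gameOp A s‖ * ‖z - s‖ ≤ L * 2 * ‖z - s‖ := by gcongr
  linarith

/-- The duality gap after a projected gradient step is bounded by the length of the step. -/
theorem dualityGap_proj_le (hL0 : 0 < L) (hne : (feasible n m).Nonempty) (a g : Profile n m) :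
    dualityGap A (proj (a - (1 / (8 * L)) • g)) ≤
      2 * (8 * L * ‖a - proj (a - (1 / (8 * L)) • g)‖ +
        ‖gameOp A (proj (a - (1 / (8 * L)) • g)) - g‖) := by
  set b := proj (a - (1 / (8 * L)) • g) with hb
  have hbf : b ∈ feasible n m := proj_mem hne _
  refine (dualityGap_le_iff hbf).mpr fun w hw => ?_
  have h0 := inner_proj_le_zero (a - (1 / (8 * L)) • g) hw
  rw [← hb] at h0
  have h1 : 1 / (8 * L) * ⟪g, b - w⟫ ≤ ⟪a - b, b - w⟫ := by
    have e : ⟪a - (1 / (8 * L)) • g - b, w - b⟫ =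
        1 / (8 * L) * ⟪g, b - w⟫ - ⟪a - b, b - w⟫ := by
      rw [show a - (1 / (8 * L)) • g - b = (a - b) - (1 / (8 * L)) • g by abel,
        ← neg_sub b w, inner_neg_right, inner_sub_left, real_inner_smul_left]
      ring
    linarith
  have h2 := real_inner_le_norm (a - b) (b - w)
  have h3 := real_inner_le_norm (gameOp A b - g) (b - w)
  have h4 := norm_sub_le_two hbf hw
  have h5 : ‖a - b‖ * ‖b - w‖ ≤ ‖a - b‖ * 2 := by gcongr
  have h6 : ‖gameOp A b - g‖ * ‖b - w‖ ≤ ‖gameOp A b - g‖ * 2 := by gcongr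
  have h7 : ⟪g, b - w⟫ ≤ 8 * L * (‖a - b‖ * 2) := by
    have h8 : 1 / (8 * L) * ⟪g, b - w⟫ ≤ ‖a - b‖ * 2 := by linarith
    rwa [one_div_mul_eq_div, div_le_iff₀ (by positivity), mul_comm (‖a - b‖ * 2)] at h8
  have h8 : ⟪gameOp A b, b - w⟫ = ⟪gameOp A b - g, b - w⟫ + ⟪g, b - w⟫ := by
    rw [inner_sub_left, sub_add_cancel]
  linarith

/-- The contraction factor of the gradient methods is `1 - contraction R`. -/
noncomputable def contraction (R : ℝ) : ℝ := 1 / (12 * (1 + 9 * R) ^ 2)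

theorem contraction_le_one {R : ℝ} (hR : 0 ≤ R) : contraction R ≤ 1 := by
  unfold contraction
  rw [div_le_one (by positivity)]
  nlinarith

/-- The 12 is set by OGDA, where Y = 3(p² + q²) and the guaranteed decrease is (p² + q²)/4; EGDA has
room to spare. -/
theorem contraction_mul_le {R X Y : ℝ} (hR : 0 ≤ R) (h : X ≤ (1 + 9 * R) ^ 2 * Y) :
    contraction R * X ≤ Y / 12 := by
  unfold contraction
  rw [one_div_mul_eq_div, div_le_div_iff₀ (by positivity) (by norm_num)]
  linarith

theorem norm_scaled_gameOp_sub_le (hL0 : 0 < L) (hL : specNorm A ≤ L) (z w : Profile n m) :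
    ‖(1 / (8 * L)) • gameOp A z - (1 / (8 * L)) • gameOp A w‖ ≤ 1 / 8 * ‖z - w‖ := by
  rw [← smul_sub, norm_smul, Real.norm_of_nonneg (by positivity)]
  have h := norm_gameOp_sub_le hL z w
  calc 1 / (8 * L) * ‖gameOp A z - gameOp A w‖ ≤ 1 / (8 * L) * (L * ‖z - w‖) := by gcongr
    _ = 1 / 8 * ‖z - w‖ := by field_simp

theorem egda_mem (hne : (feasible n m).Nonempty) {η : ℝ} {z0 : Profile n m}
    (hz0 : z0 ∈ feasible n m) (t : ℕ) : egda A η z0 t ∈ feasible n m := by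
  cases t with
  | zero => exact hz0
  | succ t => exact proj_mem hne _

/-- The squared distance drops by 7/8 ‖a - b‖², with b the intermediate point. The error bound at b,
whose gap is at most 18 L ‖a - b‖, shows that ‖a - s‖ is itself a multiple of ‖a - b‖. -/
theorem egda_step (hL0 : 0 < L) (hL : specNorm A ≤ L) (hr : 0 ≤ r) (hsf : s ∈ feasible n m)
    (hs : ∀ w ∈ feasible n m, ⟪gameOp A s, s - w⟫ ≤ 0)
    (heb : ∀ z ∈ feasible n m, ‖z - s‖ ≤ r * dualityGap A z) (z0 : Profile n m) (t : ℕ) :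
    ‖egda A (1 / (8 * L)) z0 (t + 1) - s‖ ^ 2 ≤
      (1 - contraction (2 * L * r)) * ‖egda A (1 / (8 * L)) z0 t - s‖ ^ 2 := by
  have hne : (feasible n m).Nonempty := ⟨s, hsf⟩
  rw [egda]
  set a := egda A (1 / (8 * L)) z0 t
  set b := proj (a - (1 / (8 * L)) • gameOp A a) with hb
  set c := proj (a - (1 / (8 * L)) • gameOp A b)
  have hbf : b ∈ feasible n m := proj_mem hne _
  have hcf : c ∈ feasible n m := proj_mem hne _
  have h1 := extragradient_step (inner_proj_le_zero (a - (1 / (8 * L)) • gameOp A a) hcf)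
    (inner_proj_le_zero (a - (1 / (8 * L)) • gameOp A b) hsf)
  rw [← hb] at h1
  have h2 := norm_scaled_gameOp_sub_le hL0 hL a b
  have h3 : 0 ≤ ⟪(1 / (8 * L)) • gameOp A b, b - s⟫ := by
    rw [real_inner_smul_left]
    exact mul_nonneg (by positivity) (inner_gameOp_sub_nonneg hs hbf)
  have h4 := mul_le_mul_of_nonneg_right h2 (norm_nonneg (b - c))
  have h5 : ‖c - s‖ ^ 2 ≤ ‖a - s‖ ^ 2 - 7 / 8 * ‖a - b‖ ^ 2 := by
    nlinarith [sq_nonneg (‖a - b‖ - ‖b - c‖), sq_nonneg ‖b - c‖]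
  have h6 : dualityGap A b ≤ 2 * (8 * L * ‖a - b‖ + ‖gameOp A b - gameOp A a‖) :=
    dualityGap_proj_le hL0 hne a _
  have h7 := norm_gameOp_sub_le hL b a
  rw [norm_sub_rev b a] at h7
  have h8 : ‖a - s‖ ≤ (1 + 9 * (2 * L * r)) * ‖a - b‖ := by
    have e1 := heb b hbf
    have e2 : r * dualityGap A b ≤ r * (2 * (8 * L * ‖a - b‖ + L * ‖a - b‖)) := by
      refine mul_le_mul_of_nonneg_left ?_ hr
      linarith
    have e3 := norm_sub_le_norm_sub_add_norm_sub a b s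
    linarith
  have h9 : ‖a - s‖ ^ 2 ≤ (1 + 9 * (2 * L * r)) ^ 2 * ‖a - b‖ ^ 2 := by
    rw [← mul_pow]; gcongr
  have h10 := contraction_mul_le (by positivity) h9
  nlinarith [sq_nonneg ‖a - b‖]

theorem egda_rate (hL0 : 0 < L) (hL : specNorm A ≤ L) (hr : 0 ≤ r) (hsf : s ∈ feasible n m)
    (hs : ∀ w ∈ feasible n m, ⟪gameOp A s, s - w⟫ ≤ 0)
    (heb : ∀ z ∈ feasible n m, ‖z - s‖ ≤ r * dualityGap A z) {z0 : Profile n m}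
    (hz0 : z0 ∈ feasible n m) (t : ℕ) :
    ‖egda A (1 / (8 * L)) z0 t - s‖ ^ 2 ≤ 16 * (1 - contraction (2 * L * r)) ^ t := by
  induction t with
  | zero =>
    have := norm_sub_le_two hz0 hsf
    rw [egda, pow_zero]
    nlinarith [norm_nonneg (z0 - s)]
  | succ t ih =>
    refine (egda_step hL0 hL hr hsf hs heb z0 t).trans ?_
    have := contraction_le_one (R := 2 * L * r) (by positivity)
    rw [pow_succ' (1 - _)]
    nlinarith

/-- The Lyapunov function of optimistic gradient descent/ascent. -/
noncomputable def ogdaPotential (s : Profile n m) (p : Profile n m × Profile n m) : ℝ :=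
  ‖p.2 - s‖ ^ 2 + 1 / 2 * ‖p.2 - p.1‖ ^ 2

theorem ogdaState_mem (hne : (feasible n m).Nonempty) {η : ℝ} {z0 : Profile n m}
    (hz0 : z0 ∈ feasible n m) (t : ℕ) : (ogdaState A η z0 t).1 ∈ feasible n m := by
  cases t with
  | zero => exact hz0
  | succ t => exact proj_mem hne _

/-- As for EGDA, but the first gradient is taken at the old iterate z. The resulting error involves
q = ‖a - z‖, which the second term of the potential pays for. -/
theorem ogda_step (hL0 : 0 < L) (hL : specNorm A ≤ L) (hr : 0 ≤ r) (hsf : s ∈ feasible n m)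
    (hs : ∀ w ∈ feasible n m, ⟪gameOp A s, s - w⟫ ≤ 0)
    (heb : ∀ z ∈ feasible n m, ‖z - s‖ ≤ r * dualityGap A z) (z0 : Profile n m) (t : ℕ) :
    ogdaPotential s (ogdaState A (1 / (8 * L)) z0 (t + 1)) ≤
      (1 - contraction (2 * L * r)) * ogdaPotential s (ogdaState A (1 / (8 * L)) z0 t) := by
  have hne : (feasible n m).Nonempty := ⟨s, hsf⟩
  rw [ogdaState]
  simp only [ogdaPotential]
  set z := (ogdaState A (1 / (8 * L)) z0 t).1
  set a := (ogdaState A (1 / (8 * L)) z0 t).2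
  set b := proj (a - (1 / (8 * L)) • gameOp A z) with hb
  set c := proj (a - (1 / (8 * L)) • gameOp A b)
  have hbf : b ∈ feasible n m := proj_mem hne _
  have hcf : c ∈ feasible n m := proj_mem hne _
  have h1 := extragradient_step (inner_proj_le_zero (a - (1 / (8 * L)) • gameOp A z) hcf)
    (inner_proj_le_zero (a - (1 / (8 * L)) • gameOp A b) hsf)
  rw [← hb] at h1
  have h2 := norm_scaled_gameOp_sub_le hL0 hL z b
  have h3 : 0 ≤ ⟪(1 / (8 * L)) • gameOp A b, b - s⟫ := by
    rw [real_inner_smul_left]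
    exact mul_nonneg (by positivity) (inner_gameOp_sub_nonneg hs hbf)
  have h4 := mul_le_mul_of_nonneg_right h2 (norm_nonneg (b - c))
  have hzb : ‖z - b‖ ≤ ‖a - z‖ + ‖a - b‖ := by
    have := norm_sub_le_norm_sub_add_norm_sub z a b
    rwa [norm_sub_rev z a] at this
  set p := ‖a - b‖ with hp
  set q := ‖a - z‖ with hq
  set d := ‖b - c‖ with hd
  have hp0 : 0 ≤ p := norm_nonneg _
  have hq0 : 0 ≤ q := norm_nonneg _
  have hd0 : 0 ≤ d := norm_nonneg _
  have h4' : ‖z - b‖ * d ≤ (q + p) * d := by gcongr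
  have h5 : ‖c - s‖ ^ 2 + 1 / 2 * ‖c - b‖ ^ 2 ≤
      ‖a - s‖ ^ 2 + 1 / 2 * q ^ 2 - 1 / 4 * (p ^ 2 + q ^ 2) := by
    rw [norm_sub_rev c b, ← hd]
    have i1 : (q + p) * d ≤ 1 / 2 * ((q + p) ^ 2 + d ^ 2) := by
      linarith [sq_nonneg (q + p - d)]
    have i2 : (q + p) ^ 2 ≤ 2 * (p ^ 2 + q ^ 2) := by linarith [sq_nonneg (q - p)]
    linarith [sq_nonneg d, sq_nonneg p, sq_nonneg q]
  have h6 : dualityGap A b ≤ 2 * (8 * L * p + ‖gameOp A b - gameOp A z‖) :=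
    dualityGap_proj_le hL0 hne a _
  have h7 := norm_gameOp_sub_le hL b z
  rw [norm_sub_rev b z] at h7
  have h7' : L * ‖z - b‖ ≤ L * (q + p) := by gcongr
  have h8 : ‖a - s‖ ≤ (1 + 9 * (2 * L * r)) * (p + q) := by
    have e1 := heb b hbf
    have e2 : r * dualityGap A b ≤ r * (2 * (9 * L * (p + q))) := by
      refine mul_le_mul_of_nonneg_left ?_ hr
      linarith [mul_nonneg hL0.le hq0]
    have e3 := norm_sub_le_norm_sub_add_norm_sub a b s
    linarith
  have hR1 : 1 ≤ 1 + 9 * (2 * L * r) := by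
    have : 0 ≤ L * r := by positivity
    linarith
  have h9 : ‖a - s‖ ^ 2 + 1 / 2 * q ^ 2 ≤
      (1 + 9 * (2 * L * r)) ^ 2 * (3 * (p ^ 2 + q ^ 2)) := by
    have e1 : ‖a - s‖ ^ 2 ≤ (1 + 9 * (2 * L * r)) ^ 2 * (p + q) ^ 2 := by
      rw [← mul_pow]; gcongr
    have e2 : 1 ≤ (1 + 9 * (2 * L * r)) ^ 2 := one_le_pow₀ hR1
    have e3 : q ^ 2 ≤ (1 + 9 * (2 * L * r)) ^ 2 * q ^ 2 :=
      le_mul_of_one_le_left (sq_nonneg _) e2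
    have e4 : (1 + 9 * (2 * L * r)) ^ 2 * (p + q) ^ 2 ≤
        (1 + 9 * (2 * L * r)) ^ 2 * (2 * (p ^ 2 + q ^ 2)) := by
      gcongr
      linarith [sq_nonneg (p - q)]
    have e5 : 0 ≤ (1 + 9 * (2 * L * r)) ^ 2 * p ^ 2 := by positivity
    linarith [sq_nonneg q]
  have h10 := contraction_mul_le (by positivity) h9
  linarith

theorem ogda_rate (hL0 : 0 < L) (hL : specNorm A ≤ L) (hr : 0 ≤ r) (hsf : s ∈ feasible n m)
    (hs : ∀ w ∈ feasible n m, ⟪gameOp A s, s - w⟫ ≤ 0)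
    (heb : ∀ z ∈ feasible n m, ‖z - s‖ ≤ r * dualityGap A z) {z0 : Profile n m}
    (hz0 : z0 ∈ feasible n m) (t : ℕ) :
    ‖ogda A (1 / (8 * L)) z0 t - s‖ ^ 2 ≤ 16 * (1 - contraction (2 * L * r)) ^ t := by
  -- Both initial points coincide, so the potential starts at no more than 4; a squared distance is
  -- at most 4 times the potential, whence 16.
  have h : ogdaPotential s (ogdaState A (1 / (8 * L)) z0 t) ≤
      4 * (1 - contraction (2 * L * r)) ^ t := by
    induction t with
    | zero =>
      have := norm_sub_le_two hz0 hsf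
      simp only [ogdaState, ogdaPotential, pow_zero, sub_self, norm_zero]
      nlinarith [norm_nonneg (z0 - s)]
    | succ t ih =>
      refine (ogda_step hL0 hL hr hsf hs heb z0 t).trans ?_
      have := contraction_le_one (R := 2 * L * r) (by positivity)
      rw [pow_succ']
      nlinarith
  rw [ogda]
  set p := ogdaState A (1 / (8 * L)) z0 t
  simp only [ogdaPotential] at h
  have h1 := norm_sub_le_norm_sub_add_norm_sub p.1 p.2 s
  rw [norm_sub_rev p.1 p.2] at h1
  have h2 : ‖p.1 - s‖ ^ 2 ≤ (‖p.2 - p.1‖ + ‖p.2 - s‖) ^ 2 := by gcongr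
  nlinarith [sq_nonneg (‖p.2 - p.1‖ - ‖p.2 - s‖), sq_nonneg ‖p.2 - s‖]

/-- Linear convergence in distance yields `ε`-equilibria after logarithmically many steps. -/
theorem isEpsEquilibrium_of_rate {M ε P θ : ℝ} (hM : 0 < M) (hε : 0 < ε) (hεM : ε ≤ M / 2)
    (hP : 1 ≤ P) (hL0 : 0 < L) (hL : specNorm A ≤ L) (hLP : L ≤ P ^ 2 * M)
    (hθ1 : θ ≤ 1) (hsf : s ∈ feasible n m)
    (hs : ∀ w ∈ feasible n m, ⟪gameOp A s, s - w⟫ ≤ 0) {z : Profile n m}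
    (hz : z ∈ feasible n m) {t : ℕ} (hrate : ‖z - s‖ ^ 2 ≤ 16 * (1 - θ) ^ t)
    (ht : 66 * P ^ 2 * Real.log (M / ε) ≤ θ * t) : IsEpsEquilibrium A ε z := by
  refine ⟨hz, (dualityGap_le_dist hL0.le hL hsf hs hz).trans ?_⟩
  have hl : 1 / 2 ≤ Real.log (M / ε) := by
    have h2 : Real.log 2 ≤ Real.log (M / ε) := by
      refine Real.log_le_log (by norm_num) ?_
      rw [le_div_iff₀ hε]; linarith
    have := Real.log_two_gt_d9
    linarith
  have h1 : (1 - θ) ^ t ≤ Real.exp (-(θ * t)) := by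
    have := Real.one_sub_le_exp_neg θ
    calc (1 - θ) ^ t ≤ Real.exp (-θ) ^ t := by
          gcongr
      _ = Real.exp (-(θ * t)) := by rw [← Real.exp_nat_mul]; congr 1; ring
  have h2 : ‖z - s‖ ≤ 4 * Real.exp (-(θ * t) / 2) := by
    refine (sq_le_sq₀ (norm_nonneg _) (by positivity)).mp ?_
    rw [mul_pow, ← Real.exp_nat_mul]
    calc ‖z - s‖ ^ 2 ≤ 16 * Real.exp (-(θ * t)) := by linarith
      _ = 4 ^ 2 * Real.exp ((2 : ℕ) * (-(θ * t) / 2)) := by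
        norm_num
        ring
  -- This needs θt/2 ≥ log(16P²) + log(M/ε). As log(16P²) ≤ 16P² and log(M/ε) ≥ 1/2, the value 33P²
  -- log(M/ε) suffices, hence the 66.
  have h3 : Real.exp (-(θ * t) / 2) ≤ ε / (16 * P ^ 2 * M) := by
    have hpos : 0 < ε / (16 * P ^ 2 * M) := by positivity
    rw [← Real.le_log_iff_exp_le hpos]
    have e : ε / (16 * P ^ 2 * M) = (16 * P ^ 2)⁻¹ * (M / ε)⁻¹ := by field_simp
    rw [e, Real.log_mul (by positivity) (by positivity), Real.log_inv, Real.log_inv]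
    have e2 := Real.log_le_sub_one_of_pos (show 0 < 16 * P ^ 2 by positivity)
    have e3 : 1 ≤ P ^ 2 := one_le_pow₀ hP
    nlinarith
  calc 4 * L * ‖z - s‖ ≤ 4 * (P ^ 2 * M) * (4 * (ε / (16 * P ^ 2 * M))) := by
        gcongr
        exact h2.trans (by gcongr)
    _ = ε := by field_simp; norm_num

end

/-! ### Accelerated gradient steps -/

section

section Accelerated

variable {E : Type*} [NormedAddCommGroup E] [InnerProductSpace ℝ E]

/-- The estimate-sequence inequality for one step of the accelerated gradient method. -/
theorem accelerated_step {K : Set E} (hK : Convex ℝ K) {f : E → ℝ} {l t : ℝ} {z zh z' u g : E}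
    (ht : 0 ≤ t) (hl : 0 ≤ l) (hu : u = (2 / (t + 2)) • zh + (t / (t + 2)) • z)
    (hlow : ∀ w ∈ K, f u + ⟪g, w - u⟫ ≤ f w)
    (hup : ∀ w ∈ K, f w ≤ f u + ⟪g, w - u⟫ + l / 2 * ‖w - u‖ ^ 2)
    (hz : z ∈ K) (hz' : z' ∈ K)
    (hmin : ∀ w ∈ K, ⟪g, z' - u⟫ + l / 2 * ‖z' - u‖ ^ 2 ≤ ⟪g, w - u⟫ + l / 2 * ‖w - u‖ ^ 2)
    {w : E} (hw : w ∈ K) :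
    (t + 1) * (t + 2) / 4 * f z' ≤ t * (t + 1) / 4 * f z + l / 2 * ‖w - zh‖ ^ 2 +
      (t + 1) / 2 * (f u + ⟪g, w - u⟫) := by
  have ht2 : 0 < t + 2 := by linarith
  -- Comparing z' with q, which differs from u by 2/(t+2) times w - zh, is the key to acceleration.
  -- The weights satisfy (t+1)(t+2)/4 = t(t+1)/4 + (t+1)/2.
  set q := (t / (t + 2)) • z + (2 / (t + 2)) • w with hq
  have hqK : q ∈ K := hK hz hw (by positivity) (by positivity) (by field_simp)
  have hqu : q - u = (2 / (t + 2)) • (w - zh) := by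
    rw [hq, hu, smul_sub]; abel
  have h1 : f z' ≤ f u + ⟪g, q - u⟫ + l / 2 * ‖q - u‖ ^ 2 := by
    have a1 := hup z' hz'
    have a2 := hmin q hqK
    linarith
  have h2 := hlow z hz
  have e1 : ⟪g, q - u⟫ = 2 / (t + 2) * (⟪g, w⟫ - ⟪g, zh⟫) := by
    rw [hqu, inner_smul_right, inner_sub_right]
  have e2 : ‖q - u‖ ^ 2 = (2 / (t + 2)) ^ 2 * ‖w - zh‖ ^ 2 := by
    rw [hqu, norm_smul, mul_pow, Real.norm_eq_abs, sq_abs]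
  have e3 : ⟪g, u⟫ = 2 / (t + 2) * ⟪g, zh⟫ + t / (t + 2) * ⟪g, z⟫ := by
    rw [hu, inner_add_right, inner_smul_right, inner_smul_right]
  rw [e1, e2] at h1
  rw [inner_sub_right, e3] at h2
  rw [inner_sub_right, e3]
  have h3 := mul_le_mul_of_nonneg_left h1 (show 0 ≤ (t + 1) * (t + 2) / 4 by positivity)
  have h4 := mul_le_mul_of_nonneg_left h2 (show 0 ≤ t * (t + 1) / 4 by positivity)
  have h5 : (t + 1) / (t + 2) * (l / 2 * ‖w - zh‖ ^ 2) ≤ l / 2 * ‖w - zh‖ ^ 2 := by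
    refine mul_le_of_le_one_left (by positivity) ?_
    rw [div_le_one ht2]; linarith
  have e4 : (t + 1) * (t + 2) / 4 * (f u + 2 / (t + 2) * (⟪g, w⟫ - ⟪g, zh⟫) +
      l / 2 * ((2 / (t + 2)) ^ 2 * ‖w - zh‖ ^ 2)) =
      (t + 1) * (t + 2) / 4 * f u + (t + 1) / 2 * (⟪g, w⟫ - ⟪g, zh⟫) +
        (t + 1) / (t + 2) * (l / 2 * ‖w - zh‖ ^ 2) := by
    field_simp
    ring
  have e5 : t * (t + 1) / 4 * (f u + (⟪g, z⟫ - (2 / (t + 2) * ⟪g, zh⟫ + t / (t + 2) * ⟪g, z⟫))) +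
      (t + 1) / 2 * (f u + (⟪g, w⟫ - (2 / (t + 2) * ⟪g, zh⟫ + t / (t + 2) * ⟪g, z⟫))) =
      (t + 1) * (t + 2) / 4 * f u + (t + 1) / 2 * (⟪g, w⟫ - ⟪g, zh⟫) := by
    field_simp
    ring
  linarith

end Accelerated

/-! ### The smoothed gap and the Smoothing procedure -/

variable {n m : ℕ} {A : Matrix (Fin n) (Fin m) ℝ} {L η : ℝ}

/-- The strategy profile attaining the maximum in the definition of `smoothedGap`. -/
noncomputable def smoothResponse (A : Matrix (Fin n) (Fin m) ℝ) (η : ℝ) (u : Profile n m) :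
    Profile n m :=
  argminOn (fun w => ⟪gameOp A u, w⟫ + η / 2 * ‖w - uniformProfile n m‖ ^ 2) (feasible n m)

theorem smoothResponse_spec (hne : (feasible n m).Nonempty) (u : Profile n m) :
    smoothResponse A η u ∈ feasible n m ∧ ∀ w ∈ feasible n m,
      ⟪gameOp A u, smoothResponse A η u⟫ +
        η / 2 * ‖smoothResponse A η u - uniformProfile n m‖ ^ 2 ≤
      ⟪gameOp A u, w⟫ + η / 2 * ‖w - uniformProfile n m‖ ^ 2 :=
  argminOn_spec feasible_isCompact hne (by fun_prop)

theorem le_smoothedGap (u : Profile n m) {q : Profile n m} (hq : q ∈ feasible n m) :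
    ⟪gameOp A u, u - q⟫ - η / 2 * ‖q - uniformProfile n m‖ ^ 2 ≤ smoothedGap A η u := by
  refine le_ciSup (f := fun w : feasible n m => ⟪gameOp A u, u - (w : Profile n m)⟫ -
    η / 2 * ‖(w : Profile n m) - uniformProfile n m‖ ^ 2) ?_ ⟨q, hq⟩
  have h : BddAbove ((fun w : Profile n m => ⟪gameOp A u, u - w⟫ -
      η / 2 * ‖w - uniformProfile n m‖ ^ 2) '' feasible n m) :=
    feasible_isCompact.bddAbove_image (by fun_prop)
  refine h.mono ?_
  rintro _ ⟨w, rfl⟩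
  exact ⟨w, w.2, rfl⟩

theorem smoothedGap_le (hne : (feasible n m).Nonempty) {u : Profile n m} {c : ℝ}
    (h : ∀ q ∈ feasible n m,
      ⟪gameOp A u, u - q⟫ - η / 2 * ‖q - uniformProfile n m‖ ^ 2 ≤ c) :
    smoothedGap A η u ≤ c := by
  have : Nonempty (feasible n m) := hne.to_subtype
  exact ciSup_le fun w => h w w.2

theorem smoothedGap_eq (hne : (feasible n m).Nonempty) (u : Profile n m) :
    smoothedGap A η u = ⟪gameOp A u, u - smoothResponse A η u⟫ -
      η / 2 * ‖smoothResponse A η u - uniformProfile n m‖ ^ 2 := by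
  obtain ⟨h1, h2⟩ := smoothResponse_spec (A := A) (η := η) hne u
  refine le_antisymm (smoothedGap_le hne fun q hq => ?_) (le_smoothedGap u h1)
  have := h2 q hq
  rw [inner_sub_right, inner_sub_right]
  linarith

/-- By skewness ⟨F(w), w - q⟩ = ⟨F(q), w⟩, so F_η is a supremum of affine functions, and the
maximizer at u supplies a subgradient. -/
theorem smoothedGap_lower (hne : (feasible n m).Nonempty) (u w : Profile n m) :
    smoothedGap A η u + ⟪gameOp A (smoothResponse A η u), w - u⟫ ≤ smoothedGap A η w := by
  have h := le_smoothedGap (A := A) (η := η) w (smoothResponse_spec (A := A) (η := η) hne u).1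
  rw [smoothedGap_eq hne u]
  rw [inner_sub_right, gameOp_self] at h ⊢
  rw [inner_sub_right, gameOp_skew A (smoothResponse A η u), gameOp_skew A (smoothResponse A η u)]
  linarith

/-- The inner problem is η-strongly concave; its quadratic growth absorbs the cross term by Young's
inequality at the price L²/(2η) ‖w - u‖². -/
theorem smoothedGap_upper (hη : 0 < η) (hL : specNorm A ≤ L)
    (hne : (feasible n m).Nonempty) (u w : Profile n m) :
    smoothedGap A η w ≤ smoothedGap A η u + ⟪gameOp A (smoothResponse A η u), w - u⟫ +
      L ^ 2 / η / 2 * ‖w - u‖ ^ 2 := by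
  refine smoothedGap_le hne fun q hq => ?_
  obtain ⟨h1, h2⟩ := smoothResponse_spec (A := A) (η := η) hne u
  have h3 := quadratic_growth_of_min feasible_convex h1 h2 hq
  rw [smoothedGap_eq hne u]
  set p := smoothResponse A η u
  have h4 : -⟪gameOp A (w - u), q - p⟫ ≤ η / 2 * ‖q - p‖ ^ 2 + L ^ 2 / η / 2 * ‖w - u‖ ^ 2 := by
    have a1 := (abs_le.mp (abs_real_inner_le_norm (gameOp A (w - u)) (q - p))).1
    have a2 := norm_gameOp_sub_le hL w u
    rw [← gameOp_sub] at a2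
    have a3 := mul_le_mul_of_nonneg_right a2 (norm_nonneg (q - p))
    have a4 : L * ‖w - u‖ * ‖q - p‖ ≤ η / 2 * ‖q - p‖ ^ 2 + L ^ 2 / η / 2 * ‖w - u‖ ^ 2 := by
      have e : η / 2 * ‖q - p‖ ^ 2 + L ^ 2 / η / 2 * ‖w - u‖ ^ 2 - L * ‖w - u‖ * ‖q - p‖ =
          (η * ‖q - p‖ - L * ‖w - u‖) ^ 2 / (2 * η) := by field_simp; ring
      have : 0 ≤ (η * ‖q - p‖ - L * ‖w - u‖) ^ 2 / (2 * η) := by positivity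
      linarith
    linarith
  rw [gameOp_sub] at h4
  rw [gameOp_skew A p]
  simp only [inner_sub_left, inner_sub_right, gameOp_self, gameOp_sub] at h4 ⊢
  linarith

/-- The two preceding bounds hold on the whole space, so the affine approximation has a quadratic
error. -/
theorem gradient_smoothedGap (hη : 0 < η) (hne : (feasible n m).Nonempty)
    (u : Profile n m) :
    gradient (smoothedGap A η) u = gameOp A (smoothResponse A η u) := by
  refine HasGradientAt.gradient ?_
  rw [hasGradientAt_iff_isLittleO]
  refine Asymptotics.IsBigO.trans_isLittleO ?_
    (Asymptotics.isLittleO_pow_sub_sub u (show 1 < 2 by norm_num))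
  refine Asymptotics.IsBigO.of_bound (specNorm A ^ 2 / η / 2) (Filter.Eventually.of_forall ?_)
  intro w
  have h1 := smoothedGap_lower (A := A) (η := η) hne u w
  have h2 := smoothedGap_upper (A := A) hη le_rfl hne u w
  rw [Real.norm_eq_abs, Real.norm_of_nonneg (sq_nonneg _), abs_of_nonneg] <;> linarith

/-- The trajectory of `Smoothing` satisfies the estimate-sequence invariant. -/
theorem smoothingState_invariant (hη : 0 < η) (hL : specNorm A ≤ L) {z0 : Profile n m}
    (hz0 : z0 ∈ feasible n m) (t : ℕ) :
    (smoothingState A L η z0 t).z ∈ feasible n m ∧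
    ∃ (c : Profile n m) (b σ : ℝ),
      (∀ w, (smoothingState A L η z0 t).model w = ⟪c, w⟫ + b) ∧
      (∀ w ∈ feasible n m, (t : ℝ) * (t + 1) / 4 * smoothedGap A η (smoothingState A L η z0 t).z +
        L ^ 2 / η / 2 * ‖w - (smoothingState A L η z0 t).zhat‖ ^ 2 ≤
        (smoothingState A L η z0 t).model w + σ + L ^ 2 / η / 2 * ‖w - z0‖ ^ 2) ∧
      ∀ w, (smoothingState A L η z0 t).model w + σ ≤ (t : ℝ) * (t + 1) / 4 * smoothedGap A η w := by
  have hne : (feasible n m).Nonempty := ⟨z0, hz0⟩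
  induction t with
  | zero =>
    refine ⟨hz0, 0, 0, 0, fun w => ?_, fun w _ => ?_, fun w => ?_⟩ <;> simp [smoothingState]
  | succ t ih =>
    obtain ⟨hz, c, b, σ, hmod, hest, hlow⟩ := ih
    rw [smoothingState]
    set S := smoothingState A L η z0 t
    set u := (2 / ((t : ℝ) + 2)) • S.zhat + ((t : ℝ) / ((t : ℝ) + 2)) • S.z with hu
    simp only [gradient_smoothedGap hη hne u]
    set g := gameOp A (smoothResponse A η u) with hg
    have hl : L ^ 2 / (2 * η) = L ^ 2 / η / 2 := by rw [div_div, mul_comm]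
    rw [hl]
    have hl0 : 0 ≤ L ^ 2 / η := by positivity
    obtain ⟨hz', hzmin⟩ := argminOn_spec
      (f := fun w => ⟪g, w - u⟫ + L ^ 2 / η / 2 * ‖w - u‖ ^ 2) feasible_isCompact hne
      (by fun_prop)
    set z' := argminOn (fun w => ⟪g, w - u⟫ + L ^ 2 / η / 2 * ‖w - u‖ ^ 2) (feasible n m)
    have hmod' : ∀ w, S.model w + ((t : ℝ) + 1) / 2 * ⟪g, w - u⟫ =
        ⟪c + (((t : ℝ) + 1) / 2) • g, w⟫ + (b - ((t : ℝ) + 1) / 2 * ⟪g, u⟫) := by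
      intro w
      rw [hmod, inner_add_left, real_inner_smul_left, inner_sub_right]
      ring
    simp only [hmod']
    obtain ⟨hzh, hzhmin⟩ := argminOn_spec
      (f := fun w => ⟪c + (((t : ℝ) + 1) / 2) • g, w⟫ + (b - ((t : ℝ) + 1) / 2 * ⟪g, u⟫) +
        L ^ 2 / η / 2 * ‖w - z0‖ ^ 2) feasible_isCompact hne (by fun_prop)
    set zh' := argminOn (fun w => ⟪c + (((t : ℝ) + 1) / 2) • g, w⟫ +
      (b - ((t : ℝ) + 1) / 2 * ⟪g, u⟫) + L ^ 2 / η / 2 * ‖w - z0‖ ^ 2) (feasible n m)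
    -- σ accumulates the weighted values F_η(u_τ) that the algorithm's model omits; adding it turns
    -- the model into a minorant of t(t+1)/4 · F_η.
    refine ⟨hz', _, _, σ + ((t : ℝ) + 1) / 2 * smoothedGap A η u, fun w => rfl, fun w hw => ?_,
      fun w => ?_⟩
    · have h1 := quadratic_growth_of_min (c := c + (((t : ℝ) + 1) / 2) • g) (p := z0)
        (l := L ^ 2 / η) feasible_convex hzh
        (fun v hv => by have := hzhmin v hv; linarith) hw
      have h2 := accelerated_step feasible_convex (f := smoothedGap A η) (t := t)
        (Nat.cast_nonneg t) hl0 hu (fun v _ => smoothedGap_lower hne u v)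
        (fun v _ => smoothedGap_upper hη hL hne u v) hz hz' hzmin hzh
      have h3 := hest zh' hzh
      have h4 := hmod' zh'
      push_cast
      have e : ((t : ℝ) + 1) * (t + 1 + 1) / 4 = (t + 1) * (t + 2) / 4 := by ring
      rw [e]
      linarith
    · have h1 := hlow w
      have h2 := mul_le_mul_of_nonneg_left (smoothedGap_lower (A := A) (η := η) hne u w)
        (show 0 ≤ ((t : ℝ) + 1) / 2 by positivity)
      rw [← hmod']
      push_cast
      linarith

theorem sum_sq_sub_uniform_le {d : ℕ} {x : Fin d → ℝ} (hx : x ∈ stdSimplex ℝ (Fin d)) :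
    ∑ i, (x i - 1 / (d : ℝ)) ^ 2 ≤ 1 := by
  have hd : (d : ℝ) ≠ 0 := by
    rintro h
    rw [Nat.cast_eq_zero] at h
    subst h
    have := hx.2
    simp at this
  have h1 : ∀ i, (x i - 1 / (d : ℝ)) ^ 2 = x i ^ 2 - 2 / d * x i + 1 / (d : ℝ) ^ 2 := fun i => by
    field_simp
    ring
  have h2 := sum_sq_le hx
  simp only [h1, Finset.sum_add_distrib, Finset.sum_sub_distrib, ← Finset.mul_sum, hx.2]
  simp only [Finset.sum_const, Finset.card_univ, Fintype.card_fin, nsmul_eq_mul]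
  have h3 : (d : ℝ) * (1 / (d : ℝ) ^ 2) = 1 / d := by field_simp
  have h4 : 2 / (d : ℝ) * 1 = 1 / d + 1 / d := by ring
  have h5 : 0 ≤ 1 / (d : ℝ) := by positivity
  rw [h3, h4]
  linarith

/-- Feasible points lie within squared distance 2 of the uniform profile, so the penalty never
exceeds η. -/
theorem dualityGap_le_smoothedGap (hη : 0 ≤ η) {z : Profile n m} (hz : z ∈ feasible n m) :
    dualityGap A z ≤ smoothedGap A η z + η := by
  refine (dualityGap_le_iff hz).mpr fun w hw => ?_
  have h1 := le_smoothedGap (A := A) (η := η) z hw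
  have h2 : ‖w - uniformProfile n m‖ ^ 2 ≤ 2 := by
    rw [norm_sq_profile]
    have a1 := sum_sq_sub_uniform_le hw.1
    have a2 := sum_sq_sub_uniform_le hw.2
    calc _ ≤ (1 : ℝ) + 1 := add_le_add a1 a2
      _ = 2 := by norm_num
  nlinarith

theorem diam_feasible_le_two : Metric.diam (feasible n m) ≤ 2 :=
  Metric.diam_le_of_forall_dist_le (by norm_num) fun z hz w hw => by
    rw [dist_eq_norm]; exact norm_sub_le_two hz hw

theorem sum_sq_single_sub_single {d : ℕ} {i i' : Fin d} (h : i ≠ i') :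
    ∑ k, ((Pi.single i 1 : Fin d → ℝ) k - (Pi.single i' 1 : Fin d → ℝ) k) ^ 2 = 2 := by
  have h1 : ∀ k, ((Pi.single i 1 : Fin d → ℝ) k - (Pi.single i' 1 : Fin d → ℝ) k) ^ 2 =
      (Pi.single i 1 : Fin d → ℝ) k + (Pi.single i' 1 : Fin d → ℝ) k := by
    intro k
    rcases eq_or_ne k i with rfl | hk
    · simp [Pi.single_eq_of_ne h]
    · rcases eq_or_ne k i' with rfl | hk'
      · simp [Pi.single_eq_of_ne hk]
      · simp [Pi.single_eq_of_ne hk, Pi.single_eq_of_ne hk']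
  simp only [h1, Finset.sum_add_distrib, Finset.sum_pi_single']
  norm_num

theorem exists_ne_of_stdSimplex_ne {d : ℕ} {x x' : Fin d → ℝ} (hx : x ∈ stdSimplex ℝ (Fin d))
    (hx' : x' ∈ stdSimplex ℝ (Fin d)) (h : x ≠ x') : ∃ i i' : Fin d, i ≠ i' := by
  by_contra! hc
  refine h (funext fun i => ?_)
  have : ∀ p ∈ stdSimplex ℝ (Fin d), p i = 1 := fun p hp => by
    rw [← hp.2]
    exact (Finset.sum_eq_single i (fun k _ hk => absurd (hc k i) hk) (by simp)).symm
  rw [this x hx, this x' hx']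

/-- If some profile is not an equilibrium then the feasible set has two vertices. -/
theorem le_diam_feasible {z : Profile n m} (hz : z ∈ feasible n m) (hgap : dualityGap A z ≠ 0) :
    4 / 3 ≤ Metric.diam (feasible n m) := by
  -- The value 4/3 is a rational bound below √2.
  have key : ∀ p ∈ feasible n m, ∀ q ∈ feasible n m, ‖p - q‖ ^ 2 = 2 →
      4 / 3 ≤ Metric.diam (feasible n m) := by
    intro p hp q hq h
    have h1 := Metric.dist_le_diam_of_mem feasible_isCompact.isBounded hp hq
    rw [dist_eq_norm] at h1
    nlinarith [norm_nonneg (p - q)]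
  have hex : ∃ w ∈ feasible n m, w ≠ z := by
    by_contra! hc
    refine hgap (le_antisymm ((dualityGap_le_iff hz).mpr fun w hw => ?_) (dualityGap_nonneg A hz))
    rw [hc w hw, sub_self, inner_zero_right]
  obtain ⟨w, hw, hne⟩ := hex
  by_cases hx : xPart w = xPart z
  · have hy : yPart w ≠ yPart z := by
      intro hy
      refine hne ?_
      ext k
      rcases k with i | j
      · exact congrFun hx i
      · exact congrFun hy j
    obtain ⟨j, j', hj⟩ := exists_ne_of_stdSimplex_ne hw.2 hz.2 hy
    refine key (WithLp.toLp 2 (Sum.elim (xPart z) (Pi.single j 1)))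
      ⟨hz.1, single_mem_stdSimplex ℝ j⟩ (WithLp.toLp 2 (Sum.elim (xPart z) (Pi.single j' 1)))
      ⟨hz.1, single_mem_stdSimplex ℝ j'⟩ ?_
    rw [norm_sq_profile]
    change ∑ i, (xPart z i - xPart z i) ^ 2 + ∑ k, ((Pi.single j 1 : Fin m → ℝ) k -
      (Pi.single j' 1 : Fin m → ℝ) k) ^ 2 = 2
    rw [sum_sq_single_sub_single hj]
    simp
  · obtain ⟨i, i', hi⟩ := exists_ne_of_stdSimplex_ne hw.1 hz.1 hx
    refine key (WithLp.toLp 2 (Sum.elim (Pi.single i 1) (yPart z)))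
      ⟨single_mem_stdSimplex ℝ i, hz.2⟩ (WithLp.toLp 2 (Sum.elim (Pi.single i' 1) (yPart z)))
      ⟨single_mem_stdSimplex ℝ i', hz.2⟩ ?_
    rw [norm_sq_profile]
    change ∑ k, ((Pi.single i 1 : Fin n → ℝ) k - (Pi.single i' 1 : Fin n → ℝ) k) ^ 2 +
      ∑ j, (yPart z j - yPart z j) ^ 2 = 2
    rw [sum_sq_single_sub_single hi]
    simp

variable {r : ℝ} {s : Profile n m}

/-- The invariant at s, where F_η ≤ 0, bounds N(N+1)/4 · F_η(z) by L²/(2η) ‖s - z0‖². When the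
initial distance is proportional to ε, the required N no longer depends on ε. -/
theorem smoothing_dualityGap_lt (hL0 : 0 < L) (hL : specNorm A ≤ L)
    (hsf : s ∈ feasible n m) (hs : ∀ w ∈ feasible n m, ⟪gameOp A s, s - w⟫ ≤ 0)
    (hdiam : 4 / 3 ≤ Metric.diam (feasible n m)) {z0 : Profile n m} (hz0 : z0 ∈ feasible n m)
    {ε d : ℝ} (hε : 0 < ε) (hd : ‖z0 - s‖ ≤ d * ε) {N : ℕ} (hN1 : 1 ≤ N)
    (hN : 4 * L * d ≤ N) :
    dualityGap A (smoothingState A L (ε / Metric.diam (feasible n m)) z0 N).z < ε := by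
  have hne : (feasible n m).Nonempty := ⟨s, hsf⟩
  set D := Metric.diam (feasible n m) with hD
  have hD0 : 0 < D := by linarith
  have hD2 : D ≤ 2 := diam_feasible_le_two
  set η := ε / D with hη
  have hη0 : 0 < η := by positivity
  obtain ⟨hz, c, b, σ, -, hest, hlow⟩ := smoothingState_invariant hη0 hL hz0 N
  set z := (smoothingState A L η z0 N).z
  have h1 := hest s hsf
  have h2 := hlow s
  have h3 : smoothedGap A η s ≤ 0 := smoothedGap_le hne fun q hq => by
    have := hs q hq
    have : 0 ≤ η / 2 * ‖q - uniformProfile n m‖ ^ 2 := by positivity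
    linarith
  have hN1' : (1 : ℝ) ≤ N := by exact_mod_cast hN1
  have h4 : (N : ℝ) * (N + 1) / 4 * smoothedGap A η s ≤ 0 :=
    mul_nonpos_of_nonneg_of_nonpos (by positivity) h3
  have h5 : (N : ℝ) * (N + 1) / 4 * smoothedGap A η z ≤ L ^ 2 / η / 2 * ‖s - z0‖ ^ 2 := by
    have : 0 ≤ L ^ 2 / η / 2 * ‖s - (smoothingState A L η z0 N).zhat‖ ^ 2 := by positivity
    linarith
  have h6 : L ^ 2 / η / 2 * ‖s - z0‖ ^ 2 ≤ N ^ 2 / 16 * ε := by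
    rw [norm_sub_rev]
    have hd0 : 0 ≤ d := by
      have := (norm_nonneg _).trans hd
      exact nonneg_of_mul_nonneg_left this hε
    calc L ^ 2 / η / 2 * ‖z0 - s‖ ^ 2 ≤ L ^ 2 / η / 2 * (d * ε) ^ 2 := by gcongr
      _ = D / 2 * (L * d) ^ 2 * ε := by rw [hη]; field_simp
      _ ≤ 1 * (N / 4) ^ 2 * ε := by
        gcongr
        · linarith
        · linarith
      _ = N ^ 2 / 16 * ε := by ring
  have h7 : smoothedGap A η z < ε / 4 := by
    by_contra! hc
    have a1 : (N : ℝ) * (N + 1) / 4 * (ε / 4) ≤ N ^ 2 / 16 * ε :=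
      (mul_le_mul_of_nonneg_left hc (by positivity)).trans (h5.trans h6)
    have a2 : 0 < (N : ℝ) * ε := by positivity
    nlinarith
  -- The diameter bound D ≥ 4/3 leaves exactly ε/4 for the smoothed gap.
  have h8 : η ≤ 3 / 4 * ε := by
    rw [hη, div_le_iff₀ hD0]
    nlinarith
  have := dualityGap_le_smoothedGap (A := A) hη0.le hz
  linarith

theorem smoothingReturns_exists (hL0 : 0 < L) (hL : specNorm A ≤ L)
    (hsf : s ∈ feasible n m) (hs : ∀ w ∈ feasible n m, ⟪gameOp A s, s - w⟫ ≤ 0)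
    (hdiam : 4 / 3 ≤ Metric.diam (feasible n m)) {z0 : Profile n m} (hz0 : z0 ∈ feasible n m)
    {ε d : ℝ} (hε : 0 < ε) (hd : ‖z0 - s‖ ≤ d * ε) :
    ∃ (N : ℕ) (z : Profile n m), SmoothingReturns A L z0 ε N z ∧ z ∈ feasible n m ∧
      (N : ℝ) ≤ 4 * L * d + 1 := by
  classical
  have hd0 : 0 ≤ d := nonneg_of_mul_nonneg_left ((norm_nonneg _).trans hd) hε
  set p : ℕ → Prop := fun N => 1 ≤ N ∧
    dualityGap A (smoothingState A L (ε / Metric.diam (feasible n m)) z0 N).z < ε with hp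
  have hlt : ∀ N : ℕ, 1 ≤ N → 4 * L * d ≤ N → p N := fun N h1 h2 =>
    ⟨h1, smoothing_dualityGap_lt hL0 hL hsf hs hdiam hz0 hε hd h1 h2⟩
  have hmax : p (max 1 ⌈4 * L * d⌉₊) := hlt _ (le_max_left _ _)
    ((Nat.le_ceil _).trans (by exact_mod_cast le_max_right _ _))
  have hex : ∃ N, p N := ⟨_, hmax⟩
  have hspec := Nat.find_spec hex
  have hη0 : 0 < ε / Metric.diam (feasible n m) := by
    have : 0 < Metric.diam (feasible n m) := by linarith
    positivity
  refine ⟨Nat.find hex, _, ⟨hspec.1, rfl, hspec.2, fun k hk1 hk hlt' =>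
    Nat.find_min hex hk ⟨hk1, hlt'⟩⟩, (smoothingState_invariant hη0 hL hz0 _).1, ?_⟩
  have h1 : ((Nat.find hex : ℕ) : ℝ) ≤ ((max 1 ⌈4 * L * d⌉₊ : ℕ) : ℝ) := by
    exact_mod_cast Nat.find_min' hex hmax
  refine h1.trans ?_
  rw [Nat.cast_max, Nat.cast_one]
  have h0 : 0 ≤ 4 * L * d := by positivity
  exact max_le (by linarith) (Nat.ceil_lt_add_one h0).le

end

/-! ### Counting the iterations of IterSmooth -/

section

variable {n m : ℕ} {A : Matrix (Fin n) (Fin m) ℝ} {L r : ℝ} {s : Profile n m}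

theorem dualityGap_le_two_mul {M : ℝ} (hM : ∀ i j, |A i j| ≤ M) {z : Profile n m}
    (hz : z ∈ feasible n m) : dualityGap A z ≤ 2 * M := by
  refine (dualityGap_le_iff hz).mpr fun w hw => ?_
  rw [inner_gameOp_sub]
  have h1 := abs_dot_le_of_mem_stdSimplex hz.1 (abs_mulVec_le hM hw.2)
  have h2 := abs_dot_le_of_mem_stdSimplex hw.1 (abs_mulVec_le hM hz.2)
  linarith [(abs_le.mp h1).2, (abs_le.mp h2).1]

theorem log_two_le_log_div {M ε : ℝ} (hε : 0 < ε) (hεM : ε ≤ M / 2) :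
    Real.log 2 ≤ Real.log (M / ε) := by
  refine Real.log_le_log (by norm_num) ?_
  rw [le_div_iff₀ hε]; linarith

/-- `IterSmooth` makes logarithmically many calls to `Smoothing`, each of bounded length. -/
theorem iterSmoothReturns_exists {M ε ρ : ℝ} (hM : ∀ i j, |A i j| ≤ M) (hε : 0 < ε)
    (hεM : ε ≤ M / 2) (hL0 : 0 < L) (hL : specNorm A ≤ L) (hr : 0 ≤ r)
    (hsf : s ∈ feasible n m) (hs : ∀ w ∈ feasible n m, ⟪gameOp A s, s - w⟫ ≤ 0)
    (heb : ∀ z ∈ feasible n m, ‖z - s‖ ≤ r * dualityGap A z) {z0 : Profile n m}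
    (hz0 : z0 ∈ feasible n m) (hρ : 1 < ρ) (hgap : dualityGap A z0 ≠ 0) :
    ∃ (K : ℕ) (zout : Profile n m), IterSmoothReturns A L z0 ρ ε K zout ∧
      IsEpsEquilibrium A ε zout ∧
      (K : ℝ) ≤ ρ * (1 + 1 / Real.log ρ) * (2 * (4 * (L * r) + 1) * Real.log (M / ε)) := by
  classical
  have hdiam := le_diam_feasible hz0 hgap
  have hρ0 : 0 < ρ := by linarith
  set B := 4 * L * (r * ρ) + 1 with hB
  have step : ∀ (z : Profile n m) (e : ℝ), z ∈ feasible n m → 0 < e → dualityGap A z ≤ ρ * e →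
      ∃ (z' : Profile n m) (N : ℕ), SmoothingReturns A L z e N z' ∧ z' ∈ feasible n m ∧
        (N : ℝ) ≤ B := by
    intro z e hz he hze
    obtain ⟨N, z', h1, h2, h3⟩ := smoothingReturns_exists (d := r * ρ) hL0 hL hsf hs hdiam hz he
      (by
        have := mul_le_mul_of_nonneg_left hze hr
        linarith [heb z hz])
    exact ⟨z', N, h1, h2, h3⟩
  -- Total functions with junk values off the hypotheses let the run be defined by plain recursion,
  -- feasibility being proved afterwards.
  choose! nxt len hstep using step
  set g := dualityGap A z0 with hg
  have hg0 : 0 < g := lt_of_le_of_ne (dualityGap_nonneg A hz0) (Ne.symm hgap)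
  set tol : ℕ → ℝ := fun t => g / ρ ^ t with htol
  have htol0 : ∀ t, 0 < tol t := fun t => by positivity
  have htols : ∀ t, tol (t + 1) = tol t / ρ := fun t => by
    simp only [htol, pow_succ, div_div]
  have htolr : ∀ t, tol t = ρ * tol (t + 1) := fun t => by
    rw [htols, mul_div_cancel₀ _ hρ0.ne']
  set z : ℕ → Profile n m := fun t => Nat.rec z0 (fun t p => nxt p (tol (t + 1))) t with hz
  have hzs : ∀ t, z (t + 1) = nxt (z t) (tol (t + 1)) := fun t => rfl
  have hinv : ∀ t, z t ∈ feasible n m ∧ dualityGap A (z t) ≤ tol t := by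
    intro t
    induction t with
    | zero => exact ⟨hz0, by simp [htol, hz, hg]⟩
    | succ t ih =>
      obtain ⟨h1, h2, -⟩ := hstep (z t) (tol (t + 1)) ih.1 (htol0 _) (htolr t ▸ ih.2)
      rw [hzs]
      exact ⟨h2, h1.2.2.1.le⟩
  have hrun : ∀ t, SmoothingReturns A L (z t) (tol (t + 1)) (len (z t) (tol (t + 1))) (z (t + 1)) ∧
      (len (z t) (tol (t + 1)) : ℝ) ≤ B := fun t => by
    obtain ⟨h1, -, h3⟩ := hstep (z t) (tol (t + 1)) (hinv t).1 (htol0 _) (htolr t ▸ (hinv t).2)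
    exact ⟨h1, h3⟩
  set l := Real.log (M / ε) with hl
  have hl2 : Real.log 2 ≤ l := log_two_le_log_div hε hεM
  have hlog2 := Real.log_two_gt_d9
  have hM0 : 0 < M := by linarith
  have hlρ : 0 < Real.log ρ := Real.log_pos hρ
  -- The initial gap is at most 2M and log(2M/ε) ≤ 2 log(M/ε), so after T0 calls the tolerance is at
  -- most ε. The maximum reflects that at least one call is made.
  set T0 := max 1 ⌈2 * l / Real.log ρ⌉₊ with hT0
  have hT0l : 2 * l ≤ T0 * Real.log ρ := by
    rw [← div_le_iff₀ hlρ]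
    exact (Nat.le_ceil _).trans (by exact_mod_cast le_max_right _ _)
  have hT0tol : tol T0 ≤ ε := by
    rw [htol, div_le_iff₀ (by positivity), mul_comm, ← div_le_iff₀ hε]
    rw [← Real.log_le_log_iff (by positivity) (by positivity), Real.log_pow]
    have h1 : Real.log (g / ε) ≤ Real.log (2 * (M / ε)) := by
      refine Real.log_le_log (by positivity) ?_
      rw [← mul_div_assoc]
      gcongr
      exact dualityGap_le_two_mul hM hz0
    rw [Real.log_mul (by norm_num) (by positivity)] at h1
    linarith
  have hT0p : 1 ≤ T0 ∧ dualityGap A (z T0) < ε := by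
    refine ⟨le_max_left _ _, ?_⟩
    obtain ⟨k, hk⟩ : ∃ k, T0 = k + 1 := ⟨T0 - 1, by omega⟩
    have := (hrun k).1.2.2.1
    rw [← hk] at this
    exact this.trans_le hT0tol
  have hex : ∃ T, 1 ≤ T ∧ dualityGap A (z T) < ε := ⟨T0, hT0p⟩
  have hspec := Nat.find_spec hex
  refine ⟨_, _, ⟨Nat.find hex, z, tol, fun t => len (z t) (tol (t + 1)), rfl, by simp [htol, hg],
    fun t _ => ⟨htols t, (hrun t).1⟩, hspec.1, hspec.2,
    fun t ht1 ht hlt => Nat.find_min hex ht ⟨ht1, hlt⟩, rfl, rfl⟩,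
    ⟨(hinv _).1, hspec.2.le⟩, ?_⟩
  have hTT : ((Nat.find hex : ℕ) : ℝ) ≤ 2 * l * (1 + 1 / Real.log ρ) := by
    have h1 : ((Nat.find hex : ℕ) : ℝ) ≤ (T0 : ℝ) := by exact_mod_cast Nat.find_min' hex hT0p
    have h0 : 0 ≤ 2 * l / Real.log ρ := div_nonneg (by linarith) hlρ.le
    have h2 : (T0 : ℝ) ≤ 2 * l / Real.log ρ + 1 := by
      rw [hT0, Nat.cast_max, Nat.cast_one]
      exact max_le (by linarith) (Nat.ceil_lt_add_one h0).le
    have h3 : 2 * l * (1 + 1 / Real.log ρ) = 2 * l / Real.log ρ + 2 * l := by ring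
    linarith
  have hB0 : 0 ≤ B := by positivity
  have hBρ : B ≤ ρ * (4 * (L * r) + 1) := by rw [hB]; linarith
  rw [Nat.cast_sum]
  calc ∑ t ∈ Finset.range (Nat.find hex), (len (z t) (tol (t + 1)) : ℝ)
      ≤ ∑ _t ∈ Finset.range (Nat.find hex), B := Finset.sum_le_sum fun t _ => (hrun t).2
    _ = (Nat.find hex : ℝ) * B := by simp
    _ ≤ 2 * l * (1 + 1 / Real.log ρ) * (ρ * (4 * (L * r) + 1)) :=
        mul_le_mul hTT hBρ hB0 (by have : 0 ≤ l := by linarith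
                                   positivity)
    _ = ρ * (1 + 1 / Real.log ρ) * (2 * (4 * (L * r) + 1) * l) := by ring

/-- Origin of the final constants: the exponent is 26 = 2 + 2 · 12, and 66 · 12 · 181² is below
10^8. -/
theorem le_contraction_mul {P R l t : ℝ} (hP : 1 ≤ P) (hl : 0 ≤ l) (hR0 : 0 ≤ R)
    (hR : R ≤ 20 * P ^ 12) (ht : 10 ^ 8 * P ^ 26 * l ≤ t) :
    66 * P ^ 2 * l ≤ contraction R * t := by
  have hP12 : 1 ≤ P ^ 12 := one_le_pow₀ hP
  have h1 : (1 + 9 * R) ^ 2 ≤ (181 * P ^ 12) ^ 2 :=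
    pow_le_pow_left₀ (by linarith) (by linarith) 2
  have h2 : 0 ≤ P ^ 26 * l := by positivity
  rw [contraction, one_div_mul_eq_div, le_div_iff₀ (by positivity)]
  calc 66 * P ^ 2 * l * (12 * (1 + 9 * R) ^ 2)
      ≤ 66 * P ^ 2 * l * (12 * (181 * P ^ 12) ^ 2) := by gcongr
    _ = 25946712 * (P ^ 26 * l) := by ring
    _ ≤ 10 ^ 8 * (P ^ 26 * l) := mul_le_mul_of_nonneg_right (by norm_num) h2
    _ = 10 ^ 8 * P ^ 26 * l := by ring
    _ ≤ t := ht

theorem mul_error_constant_le {P L M : ℝ} (hM : 0 < M) (hP : 1 ≤ P) (hLP : L ≤ P ^ 2 * M) :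
    L * (10 * P ^ 10 / M) ≤ 10 * P ^ 12 := by
  calc L * (10 * P ^ 10 / M) ≤ P ^ 2 * M * (10 * P ^ 10 / M) := by gcongr
    _ = 10 * P ^ 12 := by field_simp

theorem iteration_constant_le {P a c l : ℝ} (hP : 1 ≤ P) (ha : a ≤ 10 * P ^ 12) (hc : 0 ≤ c)
    (hl : 0 ≤ l) : c * (2 * (4 * a + 1) * l) ≤ c * (10 ^ 8 * P ^ 26 * l) := by
  have h1 : P ^ 12 ≤ P ^ 26 := pow_le_pow_right₀ hP (by norm_num)
  have h2 : 1 ≤ P ^ 12 := one_le_pow₀ hP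
  have h3 : 2 * (4 * a + 1) ≤ 10 ^ 8 * P ^ 26 := by linarith
  exact mul_le_mul_of_nonneg_left (mul_le_mul_of_nonneg_right h3 hl) hc

end

end ZeroSum

/-! ### Assembly -/

theorem mainTheorem4 :
    ∃ (C : ℝ) (k : ℕ),
      ∀ (n m : ℕ) (A : Matrix (Fin n) (Fin m) ℝ) (M δ ε L : ℝ) (z0 : ZeroSum.Profile n m),
        0 < M → (∀ i j, |A i j| ≤ M) →
        ZeroSum.SupportStable A δ →
        0 < ε → ε ≤ M / 2 →
        0 < L → ZeroSum.specNorm A ≤ L → L ≤ n * m * M →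
        z0 ∈ ZeroSum.feasible n m →
        -- optimistic gradient descent/ascent
        (∀ t : ℕ, C * (n + m + M / δ) ^ k * Real.log (M / ε) ≤ t →
          ZeroSum.IsEpsEquilibrium A ε (ZeroSum.ogda A (1 / (8 * L)) z0 t)) ∧
        -- extra-gradient descent/ascent
        (∀ t : ℕ, C * (n + m + M / δ) ^ k * Real.log (M / ε) ≤ t →
          ZeroSum.IsEpsEquilibrium A ε (ZeroSum.egda A (1 / (8 * L)) z0 t)) ∧
        -- iterative smoothing
        (∀ ρ : ℝ, 1 < ρ → ZeroSum.dualityGap A z0 ≠ 0 →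
          ∃ (K : ℕ) (zout : ZeroSum.Profile n m),
            ZeroSum.IterSmoothReturns A L z0 ρ ε K zout ∧
            ZeroSum.IsEpsEquilibrium A ε zout ∧
            (K : ℝ) ≤ ρ * (1 + 1 / Real.log ρ) *
              (C * (n + m + M / δ) ^ k * Real.log (M / ε))) := by
  refine ⟨10 ^ 8, 26, fun n m A M δ ε L z0 hM0 hM hstab hε hεM hL0 hL hLM hz0 => ?_⟩
  obtain ⟨s, hsf, hs, heb⟩ := hstab.error_bound hM0 hM
  have hp0 : 0 < M / δ := div_pos hM0 hstab.1
  set P : ℝ := n + m + M / δ with hP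
  set r : ℝ := 10 * P ^ 10 / M with hr
  set l := Real.log (M / ε) with hl
  have hn0 : (0 : ℝ) ≤ n := Nat.cast_nonneg n
  have hm0 : (0 : ℝ) ≤ m := Nat.cast_nonneg m
  have hn1 : (1 : ℝ) ≤ n := by
    have hn : n ≠ 0 := by
      rintro rfl
      have := hz0.1.2
      simp at this
    exact_mod_cast Nat.one_le_iff_ne_zero.mpr hn
  have hP1 : 1 ≤ P := by rw [hP]; linarith
  have hP0 : 0 < P := by linarith
  have hl0 : 0 ≤ l := (Real.log_nonneg one_le_two).trans (ZeroSum.log_two_le_log_div hε hεM)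
  have hr0 : 0 ≤ r := by positivity
  have hLP : L ≤ P ^ 2 * M := by
    refine hLM.trans (mul_le_mul_of_nonneg_right ?_ hM0.le)
    rw [pow_two]
    exact mul_le_mul (by linarith) (by linarith) hm0 hP0.le
  have hLr : L * r ≤ 10 * P ^ 12 := ZeroSum.mul_error_constant_le hM0 hP1 hLP
  have hR0 : 0 ≤ 2 * L * r := by positivity
  have hθ := fun t : ℕ => ZeroSum.le_contraction_mul (t := t) hP1 hl0 hR0 (by linarith)
  have hθ1 := ZeroSum.contraction_le_one hR0
  refine ⟨fun t ht => ?_, fun t ht => ?_, fun ρ hρ hgap => ?_⟩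
  · exact ZeroSum.isEpsEquilibrium_of_rate hM0 hε hεM hP1 hL0 hL hLP hθ1 hsf hs
      (ZeroSum.ogdaState_mem ⟨s, hsf⟩ hz0 t)
      (ZeroSum.ogda_rate hL0 hL hr0 hsf hs heb hz0 t) (hθ t ht)
  · exact ZeroSum.isEpsEquilibrium_of_rate hM0 hε hεM hP1 hL0 hL hLP hθ1 hsf hs
      (ZeroSum.egda_mem ⟨s, hsf⟩ hz0 t)
      (ZeroSum.egda_rate hL0 hL hr0 hsf hs heb hz0 t) (hθ t ht)
  · obtain ⟨K, zout, h1, h2, h3⟩ :=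
      ZeroSum.iterSmoothReturns_exists hM hε hεM hL0 hL hr0 hsf hs heb hz0 hρ hgap
    refine ⟨K, zout, h1, h2, h3.trans ?_⟩
    have hlρ : 0 < Real.log ρ := Real.log_pos hρ
    exact ZeroSum.iteration_constant_le hP1 hLr (by positivity) hl0
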